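/- Let $0<\alpha<\tfrac12$, $r>0$, $T>0$. For $a\le b$ let $W_1^\alpha(a,b)$ be the normed space of measurable $f:[a,b]\to\mathbb R$ with $$\|f\|_{\alpha,1}=\sup_{u\in[a,b]}\Big(|f(u)|+\int_a^u\frac{|f(u)-f(v)|}{(u-v)^{\alpha+1}}\,dv\Big)<\infty,$$ and let $W_2^{1-\alpha}(0,T)$ be the seminormed space of measurable $g:[0,T]\to\mathbb R$ with $$\|g\|_{1-\alpha,2}=\sup_{0\le u<v\le T}\Big(\frac{|g(v)-g(u)|}{(v-u)^{1-\alpha}}+\int_u^v\frac{|g(y)-g(u)|}{(y-u)^{2-\alpha}}\,dy\Big)<\infty.$$ For $f\in W_1^\alpha(0,T)$, $g\in W_2^{1-\alpha}(0,T)$ and $t\in[0,T]$, $\int_0^t f\,dg$ denotes the generalized Stieltjes integral $$\int_0^t f\,dg=(-1)^\alpha\int_0^t D^\alpha_{0+}f(s)\,D^{1-\alpha}_{t-}g_{t-}(s)\,ds,\qquad g_{t-}(s)=g(s)-g(t),$$ where $$D^{\alpha}_{0+}f(s)=\frac1{\Gamma(1-\alpha)}\Big(\frac{f(s)}{s^\alpha}+\alpha\int_0^s\frac{f(s)-f(u)}{(s-u)^{\alpha+1}}\,du\Big),$$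 $$D^{1-\alpha}_{t-}k(s)=\frac{(-1)^{1-\alpha}}{\Gamma(\alpha)}\Big(\frac{k(s)}{(t-s)^{1-\alpha}}+(1-\alpha)\int_s^t\frac{k(s)-k(u)}{(u-s)^{2-\alpha}}\,du\Big),$$ and $(-1)^\alpha(-1)^{1-\alpha}=-1$. Let $b,\sigma:\mathbb R\to\mathbb R$ be twice continuously differentiable with bounded first and second derivatives, let $\eta:[-r,0]\to\mathbb R$, and let $$W_2^{1-\alpha}(0,T)\to W_1^\alpha(-r,T-r),\qquad g\mapsto\bar x^g,$$ be continuously Fréchet differentiable, with derivative in the direction $h$ denoted by $D_h\bar x^g$. Then for every $g\in W_2^{1-\alpha}(0,T)$ the equation $$x^g_t=\eta_0+\int_0^t b(x^g_s)\,ds+\int_0^t\sigma(\bar x^g_{s-r})\,dg_s,\quad t\in[0,T],\qquad x^g_t=\eta_t,\quad t\in[-r,0],$$ has exactly one solution $x^g:[-r,T]\to\mathbb R$ whose restriction to $[0,T]$ lies in $W_1^\alpha(0,T)$. The map $g\mapsto x^g$ from $W_2^{1-\alpha}(0,T)$ to $W_1^\alpha(0,T)$ is Fréchet differentiable, and for all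 $g,h\in W_2^{1-\alpha}(0,T)$ its derivative $D_hx^g$ at $g$ in the direction $h$ satisfies, for all $t\in[0,T]$, $$D_hx^g_t=\int_0^t b'(x^g_s)\,D_hx^g_s\,ds+\int_0^t\sigma(\bar x^g_{s-r})\,dh_s+\int_0^t\sigma'(\bar x^g_{s-r})\,D_h\bar x^g_{s-r}\,dg_s.$$ -/

import Mathlib

open MeasureTheory Set
open scoped ENNReal

namespace FracDelay

noncomputable section

/-- The extended norm
`sup_{u ∈ [a,b]} ( |f(u)| + ∫_a^u |f(u) - f(v)| / (u - v)^(α+1) dv ) ∈ [0, ∞]`. -/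
def w1ENorm (α a b : ℝ) (f : ℝ → ℝ) : ℝ≥0∞ :=
  ⨆ u ∈ Icc a b,
    (‖f u‖ₑ + ∫⁻ v in Ioo a u, ‖f u - f v‖ₑ / ENNReal.ofReal ((u - v) ^ (α + 1)))

/-- The extended seminorm
`sup_{0 ≤ u < v ≤ T} ( |g(v) - g(u)| / (v-u)^(1-α) + ∫_u^v |g(y) - g(u)| / (y-u)^(2-α) dy )`. -/
def w2ENorm (α T : ℝ) (g : ℝ → ℝ) : ℝ≥0∞ :=
  ⨆ u ∈ Icc 0 T, ⨆ v ∈ Ioc u T,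
    (‖g v - g u‖ₑ / ENNReal.ofReal ((v - u) ^ (1 - α))
      + ∫⁻ y in Ioo u v, ‖g y - g u‖ₑ / ENNReal.ofReal ((y - u) ^ (2 - α)))

/-- Subadditivity of the integral terms that occur in both norms. -/
theorem lintegral_incr_add_le {s : Set ℝ} {k : ℝ → ℝ} (hk : Measurable k) {f g : ℝ → ℝ}
    (hf : AEMeasurable f (volume.restrict s)) (u : ℝ) :
    (∫⁻ v in s, ‖(f + g) u - (f + g) v‖ₑ / ENNReal.ofReal (k v)) ≤
      (∫⁻ v in s, ‖f u - f v‖ₑ / ENNReal.ofReal (k v))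
        + ∫⁻ v in s, ‖g u - g v‖ₑ / ENNReal.ofReal (k v) := by
  rw [← lintegral_add_left']
  · refine lintegral_mono fun v => ?_
    rw [← ENNReal.add_div]
    gcongr
    have : (f + g) u - (f + g) v = (f u - f v) + (g u - g v) := by
      simp only [Pi.add_apply]; ring
    rw [this]
    exact enorm_add_le _ _
  · exact ((aemeasurable_const.sub hf).enorm).div (hk.ennreal_ofReal.aemeasurable)

theorem lintegral_incr_smul {s : Set ℝ} {k : ℝ → ℝ} (c : ℝ) (f : ℝ → ℝ) (u : ℝ) :
    (∫⁻ v in s, ‖(c • f) u - (c • f) v‖ₑ / ENNReal.ofReal (k v)) =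
      ‖c‖ₑ * ∫⁻ v in s, ‖f u - f v‖ₑ / ENNReal.ofReal (k v) := by
  rw [← lintegral_const_mul' _ _ enorm_ne_top]
  refine lintegral_congr fun v => ?_
  rw [← mul_div_assoc, ← enorm_mul]
  simp only [Pi.smul_apply, smul_eq_mul, mul_sub]

theorem w1ENorm_add_le (α a b : ℝ) {f g : ℝ → ℝ}
    (hf : AEMeasurable f (volume.restrict (Icc a b))) :
    w1ENorm α a b (f + g) ≤ w1ENorm α a b f + w1ENorm α a b g := by
  refine iSup₂_le fun u hu => ?_
  have hf' : AEMeasurable f (volume.restrict (Ioo a u)) :=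
    hf.mono_measure (Measure.restrict_mono
      (show Ioo a u ⊆ Icc a b from fun x hx => ⟨hx.1.le, hx.2.le.trans hu.2⟩) le_rfl)
  have hk : Measurable fun v : ℝ => (u - v) ^ (α + 1) := by fun_prop
  have h1 := le_iSup₂ (f := fun u (_ : u ∈ Icc a b) => ‖f u‖ₑ +
    ∫⁻ v in Ioo a u, ‖f u - f v‖ₑ / ENNReal.ofReal ((u - v) ^ (α + 1))) u hu
  have h2 := le_iSup₂ (f := fun u (_ : u ∈ Icc a b) => ‖g u‖ₑ +
    ∫⁻ v in Ioo a u, ‖g u - g v‖ₑ / ENNReal.ofReal ((u - v) ^ (α + 1))) u hu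
  refine le_trans ?_ (add_le_add h1 h2)
  refine (add_le_add (enorm_add_le (f u) (g u)) (lintegral_incr_add_le hk hf' u)).trans ?_
  rw [add_add_add_comm]

theorem w1ENorm_smul (α a b c : ℝ) (f : ℝ → ℝ) :
    w1ENorm α a b (c • f) = ‖c‖ₑ * w1ENorm α a b f := by
  simp only [w1ENorm, ENNReal.mul_iSup, mul_add, lintegral_incr_smul]
  simp only [Pi.smul_apply, smul_eq_mul, enorm_mul]

theorem w2ENorm_eq (α T : ℝ) (g : ℝ → ℝ) : w2ENorm α T g =
    ⨆ u ∈ Icc 0 T, ⨆ v ∈ Ioc u T,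
    (‖g u - g v‖ₑ / ENNReal.ofReal ((v - u) ^ (1 - α))
      + ∫⁻ y in Ioo u v, ‖g u - g y‖ₑ / ENNReal.ofReal ((y - u) ^ (2 - α))) := by
  simp only [w2ENorm, enorm_sub_rev]

theorem w2ENorm_add_le (α T : ℝ) {f g : ℝ → ℝ}
    (hf : AEMeasurable f (volume.restrict (Icc 0 T))) :
    w2ENorm α T (f + g) ≤ w2ENorm α T f + w2ENorm α T g := by
  simp only [w2ENorm_eq]
  refine iSup₂_le fun u hu => iSup₂_le fun v hv => ?_
  have hf' : AEMeasurable f (volume.restrict (Ioo u v)) :=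
    hf.mono_measure (Measure.restrict_mono
      (show Ioo u v ⊆ Icc 0 T from fun x hx => ⟨hu.1.trans hx.1.le, hx.2.le.trans hv.2⟩) le_rfl)
  have hk : Measurable fun y : ℝ => (y - u) ^ (2 - α) := by fun_prop
  have key : ∀ q : ℝ → ℝ, (‖q u - q v‖ₑ / ENNReal.ofReal ((v - u) ^ (1 - α))
      + ∫⁻ y in Ioo u v, ‖q u - q y‖ₑ / ENNReal.ofReal ((y - u) ^ (2 - α))) ≤
      ⨆ u ∈ Icc 0 T, ⨆ v ∈ Ioc u T, (‖q u - q v‖ₑ / ENNReal.ofReal ((v - u) ^ (1 - α))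
      + ∫⁻ y in Ioo u v, ‖q u - q y‖ₑ / ENNReal.ofReal ((y - u) ^ (2 - α))) := fun q =>
    le_iSup₂_of_le u hu (le_iSup₂_of_le v hv le_rfl)
  refine le_trans ?_ (add_le_add (key f) (key g))
  have h0 : ‖(f + g) u - (f + g) v‖ₑ / ENNReal.ofReal ((v - u) ^ (1 - α)) ≤
      ‖f u - f v‖ₑ / ENNReal.ofReal ((v - u) ^ (1 - α)) +
      ‖g u - g v‖ₑ / ENNReal.ofReal ((v - u) ^ (1 - α)) := by
    rw [← ENNReal.add_div]
    gcongr
    have : (f + g) u - (f + g) v = (f u - f v) + (g u - g v) := by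
      simp only [Pi.add_apply]; ring
    rw [this]
    exact enorm_add_le _ _
  refine (add_le_add h0 (lintegral_incr_add_le hk hf' u)).trans ?_
  rw [add_add_add_comm]

theorem w2ENorm_smul (α T c : ℝ) (f : ℝ → ℝ) :
    w2ENorm α T (c • f) = ‖c‖ₑ * w2ENorm α T f := by
  simp only [w2ENorm_eq, ENNReal.mul_iSup, mul_add, lintegral_incr_smul]
  simp only [Pi.smul_apply, smul_eq_mul, ← mul_sub, enorm_mul, mul_div_assoc]

/-- Measurable functions on `[a,b]` with finite `w1ENorm`.  A function on `[a,b]` is represented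
by its extension by zero to `ℝ`; measurable means Lebesgue measurable on `[a,b]`. -/
def w1Submodule (α a b : ℝ) : Submodule ℝ (ℝ → ℝ) where
  carrier := {f | (∀ t, t ∉ Icc a b → f t = 0) ∧
    AEMeasurable f (volume.restrict (Icc a b)) ∧ w1ENorm α a b f < ∞}
  zero_mem' := ⟨fun _ _ => rfl, aemeasurable_const, by simp [w1ENorm]⟩
  add_mem' := fun {f g} hf hg => ⟨fun t ht => by simp [hf.1 t ht, hg.1 t ht],
    hf.2.1.add hg.2.1,
    (w1ENorm_add_le α a b hf.2.1).trans_lt (ENNReal.add_lt_top.2 ⟨hf.2.2, hg.2.2⟩)⟩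
  smul_mem' := fun c f hf => ⟨fun t ht => by simp [hf.1 t ht], hf.2.1.const_smul c, by
    rw [w1ENorm_smul]; exact ENNReal.mul_lt_top enorm_lt_top hf.2.2⟩

/-- Measurable functions on `[0,T]` (extended by zero to `ℝ`) with finite `w2ENorm`. -/
def w2Submodule (α T : ℝ) : Submodule ℝ (ℝ → ℝ) where
  carrier := {g | (∀ t, t ∉ Icc 0 T → g t = 0) ∧
    AEMeasurable g (volume.restrict (Icc 0 T)) ∧ w2ENorm α T g < ∞}
  zero_mem' := ⟨fun _ _ => rfl, aemeasurable_const, by simp [w2ENorm]⟩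
  add_mem' := fun {f g} hf hg => ⟨fun t ht => by simp [hf.1 t ht, hg.1 t ht],
    hf.2.1.add hg.2.1,
    (w2ENorm_add_le α T hf.2.1).trans_lt (ENNReal.add_lt_top.2 ⟨hf.2.2, hg.2.2⟩)⟩
  smul_mem' := fun c f hf => ⟨fun t ht => by simp [hf.1 t ht], hf.2.1.const_smul c, by
    rw [w2ENorm_smul]; exact ENNReal.mul_lt_top enorm_lt_top hf.2.2⟩

/-- The space `W_1^α(a,b)`. It is a separate type, so that it carries the topology of its norm
and not that of pointwise convergence. -/
def W1 (α a b : ℝ) : Type := w1Submodule α a b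

/-- The space `W_2^{1-α}(0,T)` (note that the parameter is `α`, not `1-α`). -/
def W2 (α T : ℝ) : Type := w2Submodule α T

instance (α a b : ℝ) : AddCommGroup (W1 α a b) :=
  inferInstanceAs (AddCommGroup (w1Submodule α a b))

instance (α a b : ℝ) : Module ℝ (W1 α a b) :=
  inferInstanceAs (Module ℝ (w1Submodule α a b))

instance (α T : ℝ) : AddCommGroup (W2 α T) :=
  inferInstanceAs (AddCommGroup (w2Submodule α T))

instance (α T : ℝ) : Module ℝ (W2 α T) :=
  inferInstanceAs (Module ℝ (w2Submodule α T))

instance (α a b : ℝ) : CoeFun (W1 α a b) (fun _ => ℝ → ℝ) := ⟨Subtype.val⟩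

instance (α T : ℝ) : CoeFun (W2 α T) (fun _ => ℝ → ℝ) := ⟨Subtype.val⟩

instance (α a b : ℝ) : Norm (W1 α a b) := ⟨fun f => (w1ENorm α a b f).toReal⟩

instance (α T : ℝ) : Norm (W2 α T) := ⟨fun g => (w2ENorm α T g).toReal⟩

theorem W1.core (α a b : ℝ) : NormedSpace.Core ℝ (W1 α a b) where
  norm_nonneg _ := ENNReal.toReal_nonneg
  norm_smul c f := by
    change (w1ENorm α a b (c • f.1)).toReal = ‖c‖ * (w1ENorm α a b f.1).toReal
    rw [w1ENorm_smul, ENNReal.toReal_mul, toReal_enorm]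
  norm_triangle f g := by
    change (w1ENorm α a b (f.1 + g.1)).toReal ≤
      (w1ENorm α a b f.1).toReal + (w1ENorm α a b g.1).toReal
    rw [← ENNReal.toReal_add f.2.2.2.ne g.2.2.2.ne]
    exact ENNReal.toReal_mono (ENNReal.add_lt_top.2 ⟨f.2.2.2, g.2.2.2⟩).ne
      (w1ENorm_add_le α a b f.2.2.1)
  norm_eq_zero_iff f := by
    change (w1ENorm α a b f.1).toReal = 0 ↔ f = 0
    constructor
    · intro h
      rcases (ENNReal.toReal_eq_zero_iff _).1 h with h | h
      · refine Subtype.ext (funext fun t => ?_)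
        change f.1 t = 0
        by_cases ht : t ∈ Icc a b
        · have h1 : w1ENorm α a b f.1 ≤ 0 := h.le
          have h2 := (iSup₂_le_iff.1 h1) t ht
          have h3 : ‖f.1 t‖ₑ ≤ 0 := le_self_add.trans h2
          simpa using h3
        · exact f.2.1 t ht
      · exact absurd h f.2.2.2.ne
    · rintro rfl
      change (w1ENorm α a b 0).toReal = 0
      simp [w1ENorm]

theorem W2.core (α T : ℝ) : SeminormedSpace.Core ℝ (W2 α T) where
  norm_nonneg _ := ENNReal.toReal_nonneg
  norm_smul c f := by
    change (w2ENorm α T (c • f.1)).toReal = ‖c‖ * (w2ENorm α T f.1).toReal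
    rw [w2ENorm_smul, ENNReal.toReal_mul, toReal_enorm]
  norm_triangle f g := by
    change (w2ENorm α T (f.1 + g.1)).toReal ≤
      (w2ENorm α T f.1).toReal + (w2ENorm α T g.1).toReal
    rw [← ENNReal.toReal_add f.2.2.2.ne g.2.2.2.ne]
    exact ENNReal.toReal_mono (ENNReal.add_lt_top.2 ⟨f.2.2.2, g.2.2.2⟩).ne
      (w2ENorm_add_le α T f.2.2.1)

instance (α a b : ℝ) : NormedAddCommGroup (W1 α a b) := NormedAddCommGroup.ofCore (W1.core α a b)

instance (α a b : ℝ) : NormedSpace ℝ (W1 α a b) := NormedSpace.ofCore (W1.core α a b)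

/-- `‖·‖_{1-α,2}` vanishes on constants, so this space is only seminormed. -/
instance (α T : ℝ) : SeminormedAddCommGroup (W2 α T) :=
  SeminormedAddCommGroup.ofCore (W2.core α T)

instance (α T : ℝ) : NormedSpace ℝ (W2 α T) where
  norm_smul_le c g := ((W2.core α T).norm_smul c g).le

/-- The left-sided fractional derivative `D_{a+}^α f (t)`. -/
def leftFracDeriv (α a : ℝ) (f : ℝ → ℝ) (t : ℝ) : ℝ :=
  1 / Real.Gamma (1 - α) *
    (f t / (t - a) ^ α + α * ∫ s in a..t, (f t - f s) / (t - s) ^ (α + 1))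

/-- The right-sided fractional derivative `D_{b-}^β f (t)` without its phase factor `(-1)^β`. -/
def rightFracDeriv (β b : ℝ) (f : ℝ → ℝ) (t : ℝ) : ℝ :=
  1 / Real.Gamma (1 - β) *
    (f t / (b - t) ^ β + β * ∫ s in t..b, (f t - f s) / (s - t) ^ (β + 1))

/-- The generalized Stieltjes integral
`∫_a^b f dg = (-1)^α ∫_a^b D_{a+}^α f(t) D_{b-}^{1-α} g_{b-}(t) dt`, `g_{b-} = g - g(b)`.
The two phase factors multiply to `(-1)^α (-1)^{1-α} = -1`. -/
def stieltjes (α a b : ℝ) (f g : ℝ → ℝ) : ℝ :=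
  -∫ t in a..b, leftFracDeriv α a f t * rightFracDeriv (1 - α) b (fun s => g s - g b) t

/-- `x : [-r,T] → ℝ` solves `x_t = η_0 + ∫_0^t b(x_s) ds + ∫_0^t σ(x̄_{s-r}) dg_s` on `[0,T]`,
`x_t = η_t` on `[-r,0]`, and `x` restricted to `[0,T]` lies in `W_1^α(0,T)`.
Values of `x` outside `[-r,T]` are irrelevant. -/
structure IsSolution (α r T : ℝ) (b σ η : ℝ → ℝ) (xbar : W1 α (-r) (T - r)) (g : W2 α T)
    (x : ℝ → ℝ) : Prop where
  mem : ∃ z : W1 α 0 T, EqOn z x (Icc 0 T)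
  init : ∀ t ∈ Icc (-r) 0, x t = η t
  eqn : ∀ t ∈ Icc 0 T, x t =
    η 0 + (∫ s in (0 : ℝ)..t, b (x s)) + stieltjes α 0 t (fun s => σ (xbar (s - r))) g

/-- `φ` is `k` times continuously differentiable and its derivatives of orders `1, …, k` are
bounded on `ℝ` (`φ` itself need not be bounded). -/
def IsCkb (k : ℕ) (φ : ℝ → ℝ) : Prop :=
  ContDiff ℝ k φ ∧ ∀ i : ℕ, 1 ≤ i → i ≤ k → ∃ C : ℝ, ∀ x, |iteratedDeriv i φ x| ≤ C

end

end FracDelay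

/-
Up to constants, `|D^α_{0+} f(u)| ≤ ‖f‖ u^{-α}`, `|D^{1-α}_{t-} g_{t-}(u)| ≤ ‖g‖`, and
`D^{1-α}_{t-} g_{t-}(u)` and `D^{1-α}_{s-} g_{s-}(u)` differ by at most
`‖g‖ (t-s)^{1-α} (s-u)^{α-1}`. Integrating over `[s,t]` and `[0,s]` gives
`|∫_0^t f dg - ∫_0^s f dg| ≤ C ‖f‖ ‖g‖ (t-s)^{1-α}`. As `1 - α > α`, the integral is therefore a
bounded bilinear map into `W_1^α(0,T)`, and the forcing term `η_0 + ∫_0^· σ(x̄_{s-r}) dg_s` is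
differentiable in `g` by the chain and product rules. The equation then reads
`x - ∫_0^· b(x_s) ds = forcing`. Some Picard iterate contracts `W_1^α(0,T)`, uniformly in the
forcing, so the left-hand side is a bijection of `W_1^α(0,T)` with Lipschitz inverse; its
derivative is of the same form with `b` replaced by multiplication by `b'(x)`, hence invertible
too, and the inverse is differentiable.
-/

namespace FracDelay

noncomputable section

section Kernels

theorem intervalIntegrable_sub_left_rpow {p : ℝ} (hp : -1 < p) (s t c : ℝ) :
    IntervalIntegrable (fun v => (c - v) ^ p) volume s t := by
  simpa using (intervalIntegral.intervalIntegrable_rpow' hp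
    (a := c - s) (b := c - t)).comp_sub_left c

theorem intervalIntegrable_sub_right_rpow {p : ℝ} (hp : -1 < p) (s t c : ℝ) :
    IntervalIntegrable (fun v => (v - c) ^ p) volume s t := by
  simpa using (intervalIntegral.intervalIntegrable_rpow' hp
    (a := s - c) (b := t - c)).comp_sub_right c

theorem integral_sub_left_rpow {p : ℝ} (hp : -1 < p) (s t : ℝ) :
    ∫ v in s..t, (t - v) ^ p = (t - s) ^ (p + 1) / (p + 1) := by
  rw [intervalIntegral.integral_comp_sub_left (fun x => x ^ p), integral_rpow (Or.inl hp),
    sub_self, Real.zero_rpow (by linarith), sub_zero]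

theorem integral_sub_right_rpow {p : ℝ} (hp : -1 < p) (s t : ℝ) :
    ∫ v in s..t, (v - s) ^ p = (t - s) ^ (p + 1) / (p + 1) := by
  rw [intervalIntegral.integral_comp_sub_right (fun x => x ^ p), integral_rpow (Or.inl hp),
    sub_self, Real.zero_rpow (by linarith), sub_zero]

theorem integral_rpow_mul_sub_rpow {p q s : ℝ} (hp : 0 < p) (hq : 0 < q) (hs : 0 < s) :
    ∫ u in (0 : ℝ)..s, u ^ (p - 1) * (s - u) ^ (q - 1) =
      s ^ (p + q - 1) * ProbabilityTheory.beta p q := by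
  have hβ : Complex.betaIntegral p q = (ProbabilityTheory.beta p q : ℂ) := by
    rw [ProbabilityTheory.beta, Complex.betaIntegral_eq_Gamma_mul_div _ _ (by simpa) (by simpa),
      ← Complex.ofReal_add]
    simp only [Complex.Gamma_ofReal, Complex.ofReal_mul, Complex.ofReal_div]
  have h := Complex.betaIntegral_scaled p q hs
  rw [hβ] at h
  apply Complex.ofReal_injective
  rw [Complex.ofReal_mul, Complex.ofReal_cpow hs.le, ← intervalIntegral.integral_ofReal]
  push_cast
  rw [← h]
  refine intervalIntegral.integral_congr fun u hu => ?_
  rw [uIcc_of_le hs.le] at hu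
  simp [Complex.ofReal_cpow hu.1, Complex.ofReal_cpow (sub_nonneg.2 hu.2)]

theorem intervalIntegrable_rpow_mul_sub_rpow {p q s : ℝ} (hp : 0 < p) (hq : 0 < q) (hs : 0 < s) :
    IntervalIntegrable (fun u => u ^ (p - 1) * (s - u) ^ (q - 1)) volume 0 s := by
  refine intervalIntegral.intervalIntegrable_of_integral_ne_zero ?_
  rw [integral_rpow_mul_sub_rpow hp hq hs]
  exact (mul_pos (Real.rpow_pos_of_pos hs _) (ProbabilityTheory.beta_pos hp hq)).ne'

end Kernels

section EnormIntegral

variable {F B : ℝ → ℝ} {s t x M C : ℝ}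

theorem enorm_div_ofReal {k : ℝ} (hk : 0 < k) (x : ℝ) :
    ‖x‖ₑ / ENNReal.ofReal k = ‖x / k‖ₑ := by
  rw [← ofReal_norm, ← ofReal_norm, norm_div, Real.norm_of_nonneg hk.le,
    ENNReal.ofReal_div_of_pos hk]

theorem enorm_add_setLIntegral_enorm_le (hst : s ≤ t) (hx : |x| ≤ M)
    (hB : IntervalIntegrable B volume s t) (h : ∀ v ∈ Ioo s t, |F v| ≤ B v) :
    ‖x‖ₑ + ∫⁻ v in Ioo s t, ‖F v‖ₑ ≤ ENNReal.ofReal (M + ∫ v in s..t, B v) := by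
  rw [intervalIntegrable_iff_integrableOn_Ioo_of_le hst] at hB
  have hB0 : ∀ v ∈ Ioo s t, 0 ≤ B v := fun v hv => (abs_nonneg _).trans (h v hv)
  rw [intervalIntegral.integral_of_le hst, integral_Ioc_eq_integral_Ioo,
    ENNReal.ofReal_add ((abs_nonneg x).trans hx) (setIntegral_nonneg measurableSet_Ioo hB0),
    ofReal_integral_eq_lintegral_ofReal hB (ae_restrict_of_forall_mem measurableSet_Ioo hB0)]
  refine add_le_add ?_ (setLIntegral_mono' measurableSet_Ioo fun v hv => ?_)
  · rw [← ofReal_norm]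
    exact ENNReal.ofReal_le_ofReal hx
  · rw [← ofReal_norm]
    exact ENNReal.ofReal_le_ofReal (h v hv)

theorem intervalIntegrable_of_enorm_add_setLIntegral_enorm_le (hst : s ≤ t)
    (hF : AEMeasurable F (volume.restrict (Ioo s t)))
    (h : ‖x‖ₑ + ∫⁻ v in Ioo s t, ‖F v‖ₑ ≤ ENNReal.ofReal C) : IntervalIntegrable F volume s t :=
  (intervalIntegrable_iff_integrableOn_Ioo_of_le hst).2
    ⟨hF.aestronglyMeasurable, (le_add_self.trans h).trans_lt ENNReal.ofReal_lt_top⟩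

theorem abs_add_integral_abs_le_of_enorm_add_setLIntegral_enorm_le (hst : s ≤ t) (hC : 0 ≤ C)
    (hF : IntervalIntegrable F volume s t)
    (h : ‖x‖ₑ + ∫⁻ v in Ioo s t, ‖F v‖ₑ ≤ ENNReal.ofReal C) :
    |x| + ∫ v in s..t, |F v| ≤ C := by
  rw [intervalIntegrable_iff_integrableOn_Ioo_of_le hst] at hF
  rw [intervalIntegral.integral_of_le hst, integral_Ioc_eq_integral_Ioo,
    ← ENNReal.ofReal_le_ofReal_iff hC,
    ENNReal.ofReal_add (abs_nonneg x) (integral_nonneg fun _ => abs_nonneg _),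
    ← Real.norm_eq_abs, ofReal_norm]
  exact (congrArg _ (ofReal_integral_norm_eq_lintegral_enorm hF)).trans_le h

end EnormIntegral

section W1

variable {α a b : ℝ}

theorem w1ENorm_eq (α a b : ℝ) (F : ℝ → ℝ) : w1ENorm α a b F =
    ⨆ u ∈ Icc a b, (‖F u‖ₑ + ∫⁻ v in Ioo a u, ‖(F u - F v) / (u - v) ^ (α + 1)‖ₑ) := by
  refine iSup_congr fun u => iSup_congr fun _ => ?_
  congr 1
  exact setLIntegral_congr_fun measurableSet_Ioo fun _ hv =>
    enorm_div_ofReal (Real.rpow_pos_of_pos (sub_pos.2 hv.2) _) _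

theorem w1ENorm_congr {f g : ℝ → ℝ} (h : EqOn f g (Icc a b)) :
    w1ENorm α a b f = w1ENorm α a b g := by
  refine iSup_congr fun u => iSup_congr fun hu => ?_
  rw [h hu]
  congr 1
  refine setLIntegral_congr_fun measurableSet_Ioo fun v hv => ?_
  rw [h ⟨hv.1.le, hv.2.le.trans hu.2⟩]

/-- The element of `W1` represented by the restriction of `F` to `[a, b]`. -/
def W1.ofFun (F : ℝ → ℝ) (hm : AEMeasurable F (volume.restrict (Icc a b)))
    (hF : w1ENorm α a b F < ∞) : W1 α a b :=
  ⟨indicator (Icc a b) F, fun _ ht => indicator_of_notMem ht _,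
    hm.indicator measurableSet_Icc, by
      rwa [w1ENorm_congr (g := F) fun t ht => indicator_of_mem ht F]⟩

theorem W1.ofFun_apply {F : ℝ → ℝ} (hm : AEMeasurable F (volume.restrict (Icc a b)))
    (hF : w1ENorm α a b F < ∞) {t : ℝ} (ht : t ∈ Icc a b) : W1.ofFun F hm hF t = F t :=
  indicator_of_mem ht F

theorem W1.norm_le (f : W1 α a b) {F : ℝ → ℝ} {C : ℝ} (hC : 0 ≤ C) (h : EqOn f F (Icc a b))
    (hF : w1ENorm α a b F ≤ ENNReal.ofReal C) : ‖f‖ ≤ C :=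
  ENNReal.toReal_le_of_le_ofReal hC ((w1ENorm_congr h).trans_le hF)

theorem W1.w1ENorm_coe (f : W1 α a b) : w1ENorm α a b f = ENNReal.ofReal ‖f‖ :=
  (ENNReal.ofReal_toReal f.2.2.2.ne).symm

theorem W1.ext {f g : W1 α a b} (h : EqOn f g (Icc a b)) : f = g := by
  refine Subtype.ext (funext fun t => ?_)
  by_cases ht : t ∈ Icc a b
  · exact h ht
  · rw [f.2.1 t ht, g.2.1 t ht]

theorem W1.add_apply (f g : W1 α a b) (t : ℝ) : (f + g) t = f t + g t := rfl
theorem W1.sub_apply (f g : W1 α a b) (t : ℝ) : (f - g) t = f t - g t := rfl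
theorem W1.smul_apply (c : ℝ) (f : W1 α a b) (t : ℝ) : (c • f) t = c * f t := rfl

theorem W1.aemeasurable_incr (f : W1 α a b) {u : ℝ} (hu : u ≤ b) :
    AEMeasurable (fun v => (f u - f v) / (u - v) ^ (α + 1)) (volume.restrict (Ioo a u)) := by
  have hf : AEMeasurable f (volume.restrict (Ioo a u)) :=
    f.2.2.1.mono_set (Ioo_subset_Icc_self.trans (Icc_subset_Icc_right hu))
  exact (aemeasurable_const.sub hf).div (by fun_prop)

theorem W1.enorm_add_setLIntegral_incr_le (f : W1 α a b) {u : ℝ} (hu : u ∈ Icc a b) :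
    ‖f u‖ₑ + ∫⁻ v in Ioo a u, ‖(f u - f v) / (u - v) ^ (α + 1)‖ₑ ≤ ENNReal.ofReal ‖f‖ := by
  rw [← f.w1ENorm_coe, w1ENorm_eq]
  exact le_iSup₂_of_le u hu le_rfl

theorem W1.intervalIntegrable_incr (f : W1 α a b) {u : ℝ} (hu : u ∈ Icc a b) :
    IntervalIntegrable (fun v => (f u - f v) / (u - v) ^ (α + 1)) volume a u :=
  intervalIntegrable_of_enorm_add_setLIntegral_enorm_le hu.1 (f.aemeasurable_incr hu.2)
    (f.enorm_add_setLIntegral_incr_le hu)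

theorem W1.abs_add_integral_abs_incr_le (f : W1 α a b) {u : ℝ} (hu : u ∈ Icc a b) :
    |f u| + ∫ v in a..u, |(f u - f v) / (u - v) ^ (α + 1)| ≤ ‖f‖ :=
  abs_add_integral_abs_le_of_enorm_add_setLIntegral_enorm_le hu.1 (norm_nonneg f)
    (f.intervalIntegrable_incr hu) (f.enorm_add_setLIntegral_incr_le hu)

theorem W1.abs_apply_le (f : W1 α a b) (u : ℝ) : |f u| ≤ ‖f‖ := by
  by_cases hu : u ∈ Icc a b
  · have h := f.abs_add_integral_abs_incr_le hu
    have h0 : 0 ≤ ∫ v in a..u, |(f u - f v) / (u - v) ^ (α + 1)| :=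
      intervalIntegral.integral_nonneg hu.1 fun _ _ => abs_nonneg _
    linarith
  · rw [f.2.1 u hu, abs_zero]
    exact norm_nonneg f

theorem W1.integral_abs_incr_le (f : W1 α a b) {u : ℝ} (hu : u ∈ Icc a b) :
    ∫ v in a..u, |(f u - f v) / (u - v) ^ (α + 1)| ≤ ‖f‖ := by
  linarith [f.abs_add_integral_abs_incr_le hu, abs_nonneg (f u)]

theorem W1.intervalIntegrable (f : W1 α a b) {s t : ℝ} (hs : s ∈ Icc a b) (ht : t ∈ Icc a b) :
    IntervalIntegrable f volume s t := by
  have hf : IntegrableOn f (Icc a b) :=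
    (integrable_const ‖f‖).mono' f.2.2.1.aestronglyMeasurable
      (Filter.Eventually.of_forall f.abs_apply_le)
  exact (hf.mono_set (uIcc_subset_Icc hs ht)).intervalIntegrable

theorem w1ENorm_le_of_dominated {F : ℝ → ℝ} {M c₁ c₂ : ℝ} (f h : W1 α a b)
    (hc₁ : 0 ≤ c₁) (hc₂ : 0 ≤ c₂) (hM : ∀ u ∈ Icc a b, |F u| ≤ M)
    (hF : ∀ u ∈ Icc a b, ∀ v ∈ Icc a b, |F u - F v| ≤ c₁ * |f u - f v| + c₂ * |h u - h v|) :
    w1ENorm α a b F ≤ ENNReal.ofReal (M + c₁ * ‖f‖ + c₂ * ‖h‖) := by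
  rw [w1ENorm_eq]
  refine iSup₂_le fun u hu => ?_
  have hf := (f.intervalIntegrable_incr hu).abs.const_mul c₁
  have hh := (h.intervalIntegrable_incr hu).abs.const_mul c₂
  refine (enorm_add_setLIntegral_enorm_le hu.1 (hM u hu) (hf.add hh) fun v hv => ?_).trans ?_
  · have hp : 0 < (u - v) ^ (α + 1) := Real.rpow_pos_of_pos (sub_pos.2 hv.2) _
    rw [abs_div, abs_div, abs_div, abs_of_pos hp, ← mul_div_assoc, ← mul_div_assoc, ← add_div]
    gcongr
    exact hF u hu v ⟨hv.1.le, hv.2.le.trans hu.2⟩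
  · rw [intervalIntegral.integral_add hf hh, intervalIntegral.integral_const_mul,
      intervalIntegral.integral_const_mul, ← add_assoc]
    gcongr
    exacts [f.integral_abs_incr_le hu, h.integral_abs_incr_le hu]

end W1

section Holder

variable {α β a b C : ℝ} {F : ℝ → ℝ}

theorem continuousOn_of_holder (hβ : 0 < β)
    (hF : ∀ u ∈ Icc a b, ∀ v ∈ Ico a u, |F u - F v| ≤ C * (u - v) ^ β) :
    ContinuousOn F (Icc a b) := by
  have hF' : ∀ u ∈ Icc a b, ∀ v ∈ Icc a b, |F v - F u| ≤ C * |v - u| ^ β := by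
    intro u hu v hv
    rcases lt_trichotomy u v with h | rfl | h
    · rw [abs_of_pos (sub_pos.2 h)]
      exact hF v hv u ⟨hu.1, h⟩
    · simp [Real.zero_rpow hβ.ne']
    · rw [abs_sub_comm, abs_sub_comm v, abs_of_pos (sub_pos.2 h)]
      exact hF u hu v ⟨hv.1, h⟩
  intro u hu
  have hlim : Filter.Tendsto (fun v => C * |v - u| ^ β) (nhds u) (nhds 0) := by
    have hc : Continuous fun v : ℝ => C * |v - u| ^ β :=
      continuous_const.mul ((continuous_id.sub continuous_const).abs.rpow_const
        fun _ => Or.inr hβ.le)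
    simpa [Real.zero_rpow hβ.ne'] using hc.tendsto u
  exact tendsto_iff_norm_sub_tendsto_zero.2 <| squeeze_zero' (Filter.Eventually.of_forall
    fun _ => norm_nonneg _) (Filter.eventually_of_mem self_mem_nhdsWithin (hF' u hu))
    (hlim.mono_left nhdsWithin_le_nhds)

/-- The constant `c` for which `‖F‖_{α,1} ≤ c C` whenever `F` vanishes at the left endpoint of an
interval of length `L` and is `(1-α)`-Hölder with constant `C` there. -/
def holderConst (α L : ℝ) : ℝ := L ^ (1 - α) + L ^ (1 - 2 * α) / (1 - 2 * α)

theorem holderConst_nonneg (hα : α < 1 / 2) {L : ℝ} (hL : 0 ≤ L) : 0 ≤ holderConst α L := by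
  have : 0 < 1 - 2 * α := by linarith
  rw [holderConst]
  positivity

theorem w1ENorm_le_of_holder (hα : α < 1 / 2) (hC : 0 ≤ C)
    (hF : ∀ u ∈ Icc a b, ∀ v ∈ Ico a u, |F u - F v| ≤ C * (u - v) ^ (1 - α)) (hFa : F a = 0) :
    w1ENorm α a b F ≤ ENNReal.ofReal (C * holderConst α (b - a)) := by
  have hα2 : 0 < 1 - 2 * α := by linarith
  rw [w1ENorm_eq]
  refine iSup₂_le fun u hu => ?_
  have hua : 0 ≤ u - a := sub_nonneg.2 hu.1
  have hsup : |F u| ≤ C * (u - a) ^ (1 - α) := by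
    rcases hu.1.eq_or_lt with rfl | h
    · rw [hFa, abs_zero]
      positivity
    · simpa [hFa] using hF u hu a ⟨le_rfl, h⟩
  refine (enorm_add_setLIntegral_enorm_le hu.1 hsup
    ((intervalIntegrable_sub_left_rpow (p := -(2 * α)) (by linarith) a u u).const_mul C)
    fun v hv => ?_).trans ?_
  · have hp : 0 < u - v := sub_pos.2 hv.2
    rw [abs_div, abs_of_pos (Real.rpow_pos_of_pos hp _), div_le_iff₀ (Real.rpow_pos_of_pos hp _),
      mul_assoc, ← Real.rpow_add hp, show -(2 * α) + (α + 1) = 1 - α by ring]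
    exact hF u hu v ⟨hv.1.le, hv.2⟩
  · rw [intervalIntegral.integral_const_mul, integral_sub_left_rpow (by linarith),
      show -(2 * α) + 1 = 1 - 2 * α by ring, ← mul_add, holderConst]
    have hub := hu.2
    have : 0 ≤ 1 - α := by linarith
    gcongr

/-- The element of `W1` given by a `(1-α)`-Hölder function on `[a, b]` vanishing at `a`. -/
def W1.ofHolder (hα : α < 1 / 2) (hC : 0 ≤ C)
    (hF : ∀ u ∈ Icc a b, ∀ v ∈ Ico a u, |F u - F v| ≤ C * (u - v) ^ (1 - α)) (hFa : F a = 0) :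
    W1 α a b :=
  W1.ofFun F ((continuousOn_of_holder (by linarith) hF).aemeasurable measurableSet_Icc)
    ((w1ENorm_le_of_holder hα hC hF hFa).trans_lt ENNReal.ofReal_lt_top)

theorem W1.ofHolder_apply (hα : α < 1 / 2) (hC : 0 ≤ C)
    (hF : ∀ u ∈ Icc a b, ∀ v ∈ Ico a u, |F u - F v| ≤ C * (u - v) ^ (1 - α)) (hFa : F a = 0)
    {t : ℝ} (ht : t ∈ Icc a b) : W1.ofHolder hα hC hF hFa t = F t :=
  W1.ofFun_apply _ _ ht

theorem W1.norm_ofHolder_le (hα : α < 1 / 2) (hC : 0 ≤ C)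
    (hF : ∀ u ∈ Icc a b, ∀ v ∈ Ico a u, |F u - F v| ≤ C * (u - v) ^ (1 - α)) (hFa : F a = 0)
    (hab : a ≤ b) :
    ‖W1.ofHolder hα hC hF hFa‖ ≤ C * holderConst α (b - a) :=
  W1.norm_le _ (mul_nonneg hC (holderConst_nonneg hα (sub_nonneg.2 hab)))
    (fun _ ht => W1.ofHolder_apply hα hC hF hFa ht) (w1ENorm_le_of_holder hα hC hF hFa)

end Holder

section W2

variable {α T u v : ℝ}

theorem W2.aemeasurable_incr (g : W2 α T) (hu : 0 ≤ u) (hv : v ≤ T) :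
    AEMeasurable (fun y => (g u - g y) / (y - u) ^ (2 - α)) (volume.restrict (Ioo u v)) := by
  have hg : AEMeasurable g (volume.restrict (Ioo u v)) :=
    g.2.2.1.mono_set (Ioo_subset_Icc_self.trans (Icc_subset_Icc hu hv))
  exact (aemeasurable_const.sub hg).div (by fun_prop)

theorem W2.enorm_add_setLIntegral_incr_le (g : W2 α T) (hu : 0 ≤ u) (huv : u < v) (hv : v ≤ T) :
    ‖(g u - g v) / (v - u) ^ (1 - α)‖ₑ +
      ∫⁻ y in Ioo u v, ‖(g u - g y) / (y - u) ^ (2 - α)‖ₑ ≤ ENNReal.ofReal ‖g‖ := by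
  have hnorm : ENNReal.ofReal ‖g‖ = w2ENorm α T g := ENNReal.ofReal_toReal g.2.2.2.ne
  rw [hnorm, w2ENorm_eq]
  refine le_iSup₂_of_le u ⟨hu, huv.le.trans hv⟩ (le_iSup₂_of_le v ⟨huv, hv⟩ (le_of_eq ?_))
  rw [enorm_div_ofReal (Real.rpow_pos_of_pos (sub_pos.2 huv) _)]
  congr 1
  exact setLIntegral_congr_fun measurableSet_Ioo fun y hy =>
    (enorm_div_ofReal (Real.rpow_pos_of_pos (sub_pos.2 hy.1) _) _).symm

theorem W2.intervalIntegrable_incr (g : W2 α T) (hu : 0 ≤ u) (huv : u < v) (hv : v ≤ T) :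
    IntervalIntegrable (fun y => (g u - g y) / (y - u) ^ (2 - α)) volume u v :=
  intervalIntegrable_of_enorm_add_setLIntegral_enorm_le huv.le (g.aemeasurable_incr hu hv)
    (g.enorm_add_setLIntegral_incr_le hu huv hv)

theorem W2.abs_div_add_integral_abs_incr_le (g : W2 α T) (hu : 0 ≤ u) (huv : u < v) (hv : v ≤ T) :
    |(g u - g v) / (v - u) ^ (1 - α)| + ∫ y in u..v, |(g u - g y) / (y - u) ^ (2 - α)| ≤ ‖g‖ :=
  abs_add_integral_abs_le_of_enorm_add_setLIntegral_enorm_le huv.le (norm_nonneg g)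
    (g.intervalIntegrable_incr hu huv hv) (g.enorm_add_setLIntegral_incr_le hu huv hv)

theorem W2.abs_sub_le (g : W2 α T) (hu : 0 ≤ u) (huv : u < v) (hv : v ≤ T) :
    |g u - g v| ≤ ‖g‖ * (v - u) ^ (1 - α) := by
  have hp : 0 < (v - u) ^ (1 - α) := Real.rpow_pos_of_pos (sub_pos.2 huv) _
  have h := g.abs_div_add_integral_abs_incr_le hu huv hv
  have h0 : 0 ≤ ∫ y in u..v, |(g u - g y) / (y - u) ^ (2 - α)| :=
    intervalIntegral.integral_nonneg huv.le fun _ _ => abs_nonneg _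
  rw [abs_div, abs_of_pos hp] at h
  rw [← div_le_iff₀ hp]
  linarith

end W2

section SingularIntegral

variable {α a d q s t : ℝ} {A B : ℝ → ℝ}

theorem ae_mem_Ioc_of_forall_mem_Ioo {p : ℝ → Prop} (h : ∀ u ∈ Ioo s t, p u) :
    ∀ᵐ u, u ∈ Ioc s t → p u := by
  filter_upwards [Measure.ae_ne volume t] with u hut hu
  exact h u ⟨hu.1, lt_of_le_of_ne hu.2 hut⟩

theorem intervalIntegrable_mul_of_abs_le_rpow (hα : α < 1) (hst : s ≤ t)
    (hAm : AEStronglyMeasurable A (volume.restrict (Ioo s t)))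
    (hBm : AEStronglyMeasurable B (volume.restrict (Ioo s t)))
    (hA : ∀ u ∈ Ioo s t, |A u| ≤ a * u ^ (-α)) (hB : ∀ u ∈ Ioo s t, |B u| ≤ q) :
    IntervalIntegrable (fun u => A u * B u) volume s t := by
  have hi : IntervalIntegrable (fun u : ℝ => a * u ^ (-α) * q) volume s t :=
    ((intervalIntegral.intervalIntegrable_rpow' (by linarith)).const_mul a).mul_const q
  rw [intervalIntegrable_iff_integrableOn_Ioo_of_le hst] at hi ⊢
  refine hi.mono' (hAm.mul hBm) (ae_restrict_of_forall_mem measurableSet_Ioo fun u hu => ?_)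
  rw [Real.norm_eq_abs, abs_mul]
  exact mul_le_mul (hA u hu) (hB u hu) (abs_nonneg _) ((abs_nonneg _).trans (hA u hu))

theorem abs_integral_mul_le_of_abs_le_rpow (h0 : 0 ≤ α) (h1 : α < 1) (ha : 0 ≤ a) (hs : 0 ≤ s)
    (hst : s ≤ t) (hA : ∀ u ∈ Ioo s t, |A u| ≤ a * u ^ (-α)) (hB : ∀ u ∈ Ioo s t, |B u| ≤ q) :
    |∫ u in s..t, A u * B u| ≤ a * q * ((t - s) ^ (1 - α) / (1 - α)) := by
  have hbound : ∀ u ∈ Ioo s t, ‖A u * B u‖ ≤ a * q * (u - s) ^ (-α) := fun u hu => by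
    have hus : u ^ (-α) ≤ (u - s) ^ (-α) :=
      Real.rpow_le_rpow_of_nonpos (sub_pos.2 hu.1) (by linarith) (by linarith)
    calc ‖A u * B u‖ = |A u| * |B u| := by rw [Real.norm_eq_abs, abs_mul]
      _ ≤ a * (u - s) ^ (-α) * q := by
          have := Real.rpow_nonneg (sub_pos.2 hu.1).le (-α)
          exact mul_le_mul ((hA u hu).trans (by gcongr)) (hB u hu) (abs_nonneg _) (by positivity)
      _ = a * q * (u - s) ^ (-α) := by ring
  have h := intervalIntegral.norm_integral_le_of_norm_le (μ := volume) hst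
    (ae_mem_Ioc_of_forall_mem_Ioo hbound)
    ((intervalIntegrable_sub_right_rpow (by linarith) s t s).const_mul _)
  rwa [intervalIntegral.integral_const_mul, integral_sub_right_rpow (by linarith),
    show -α + 1 = 1 - α by ring] at h

theorem abs_integral_mul_le_of_abs_le_rpow_sub (h0 : 0 < α) (h1 : α < 1) (ha : 0 ≤ a)
    (hd : 0 ≤ d) (hs : 0 ≤ s) (hA : ∀ u ∈ Ioo 0 s, |A u| ≤ a * u ^ (-α))
    (hB : ∀ u ∈ Ioo 0 s, |B u| ≤ d * (s - u) ^ (α - 1)) :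
    |∫ u in (0 : ℝ)..s, A u * B u| ≤ a * d * ProbabilityTheory.beta (1 - α) α := by
  have h1' : 0 < 1 - α := sub_pos.2 h1
  have hβ := ProbabilityTheory.beta_pos h1' h0
  rcases hs.eq_or_lt with rfl | hs
  · rw [intervalIntegral.integral_same, abs_zero]
    positivity
  have hbound : ∀ u ∈ Ioo 0 s,
      ‖A u * B u‖ ≤ a * d * (u ^ (1 - α - 1) * (s - u) ^ (α - 1)) := fun u hu => by
    calc ‖A u * B u‖ = |A u| * |B u| := by rw [Real.norm_eq_abs, abs_mul]
      _ ≤ a * u ^ (-α) * (d * (s - u) ^ (α - 1)) :=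
          mul_le_mul (hA u hu) (hB u hu) (abs_nonneg _) ((abs_nonneg _).trans (hA u hu))
      _ = a * d * (u ^ (1 - α - 1) * (s - u) ^ (α - 1)) := by
          rw [show 1 - α - 1 = -α by ring]
          ring
  have h := intervalIntegral.norm_integral_le_of_norm_le (μ := volume) hs.le
    (ae_mem_Ioc_of_forall_mem_Ioo hbound)
    ((intervalIntegrable_rpow_mul_sub_rpow h1' h0 hs).const_mul (a * d))
  rwa [intervalIntegral.integral_const_mul, integral_rpow_mul_sub_rpow h1' h0 hs,
    show 1 - α + α - 1 = 0 by ring, Real.rpow_zero, one_mul] at h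

theorem aestronglyMeasurable_integral_incr {S : Set ℝ} (hS : MeasurableSet S) {f : ℝ → ℝ}
    (hf : AEMeasurable f (volume.restrict S)) {D : Set (ℝ × ℝ)} (hD : MeasurableSet D)
    {k : ℝ × ℝ → ℝ} (hk : Measurable k) (hDS : ∀ u ∈ S, ∀ v, (u, v) ∈ D → v ∈ S) :
    AEStronglyMeasurable (fun u => ∫ v in {v | (u, v) ∈ D}, (f u - f v) / k (u, v))
      (volume.restrict S) := by
  set f' := hf.mk f
  have hf' : Measurable f' := hf.measurable_mk
  have hmeas : StronglyMeasurable
      fun u => ∫ v, D.indicator (fun q : ℝ × ℝ => (f' q.1 - f' q.2) / k q) (u, v) :=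
    ((((hf'.comp measurable_fst).sub (hf'.comp measurable_snd)).div hk).indicator
      hD).stronglyMeasurable.integral_prod_right'
  refine hmeas.aestronglyMeasurable.congr ?_
  filter_upwards [hf.ae_eq_mk, ae_restrict_mem hS] with u hu huS
  have hDu : MeasurableSet {v | (u, v) ∈ D} := measurable_prodMk_left hD
  have hslice : (fun v => D.indicator (fun q : ℝ × ℝ => (f' q.1 - f' q.2) / k q) (u, v)) =
      {v | (u, v) ∈ D}.indicator (fun v => (f' u - f' v) / k (u, v)) := rfl
  rw [hslice, integral_indicator hDu]
  refine setIntegral_congr_ae hDu ?_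
  filter_upwards [(ae_restrict_iff' hS).1 hf.ae_eq_mk] with v hv hvD
  rw [hv (hDS u huS v hvD), hu]

end SingularIntegral

section LeftDerivative

variable {α T u : ℝ}

theorem leftFracDeriv_congr {f g : ℝ → ℝ} (hu : 0 < u) (h : EqOn f g (Ioc 0 u)) :
    leftFracDeriv α 0 f u = leftFracDeriv α 0 g u := by
  rw [leftFracDeriv, leftFracDeriv, h ⟨hu, le_rfl⟩]
  congr 3
  refine intervalIntegral.integral_congr_ae (Filter.Eventually.of_forall fun v hv => ?_)
  rw [uIoc_of_le hu.le] at hv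
  rw [h hv]

theorem leftFracDeriv_add (f g : W1 α 0 T) (hu : u ∈ Icc 0 T) :
    leftFracDeriv α 0 (f + g) u = leftFracDeriv α 0 f u + leftFracDeriv α 0 g u := by
  simp only [leftFracDeriv, Pi.add_apply, add_sub_add_comm, add_div]
  rw [intervalIntegral.integral_add (f.intervalIntegrable_incr hu) (g.intervalIntegrable_incr hu)]
  ring

theorem leftFracDeriv_smul (c : ℝ) (f : ℝ → ℝ) (u : ℝ) :
    leftFracDeriv α 0 (c • f) u = c * leftFracDeriv α 0 f u := by
  simp only [leftFracDeriv, Pi.smul_apply, smul_eq_mul, ← mul_sub, mul_div_assoc,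
    intervalIntegral.integral_const_mul]
  ring

theorem aestronglyMeasurable_leftFracDeriv (f : W1 α 0 T) :
    AEStronglyMeasurable (leftFracDeriv α 0 f) (volume.restrict (Icc 0 T)) := by
  have hD : MeasurableSet {q : ℝ × ℝ | 0 < q.2 ∧ q.2 ≤ q.1} :=
    (measurableSet_lt measurable_const measurable_snd).inter
      (measurableSet_le measurable_snd measurable_fst)
  have hint : AEStronglyMeasurable
      (fun u => ∫ v in (0 : ℝ)..u, (f u - f v) / (u - v) ^ (α + 1))
      (volume.restrict (Icc 0 T)) := by
    refine (aestronglyMeasurable_integral_incr measurableSet_Icc f.2.2.1 hD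
      (k := fun q => (q.1 - q.2) ^ (α + 1)) (by fun_prop)
      fun u hu v hv => ⟨hv.1.le, hv.2.trans hu.2⟩).congr ?_
    filter_upwards [ae_restrict_mem measurableSet_Icc] with u hu
    rw [intervalIntegral.integral_of_le hu.1]
    rfl
  have hquot : AEMeasurable (fun u => f u / (u - 0) ^ α) (volume.restrict (Icc 0 T)) :=
    f.2.2.1.div (by fun_prop)
  exact (hquot.aestronglyMeasurable.add (hint.const_mul α)).const_mul _

theorem abs_leftFracDeriv_le (hα : α ∈ Ioo (0 : ℝ) 1) (f : W1 α 0 T) (hu : u ∈ Ioc 0 T) :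
    |leftFracDeriv α 0 f u| ≤ (1 + T ^ α) / Real.Gamma (1 - α) * ‖f‖ * u ^ (-α) := by
  have hΓ : 0 < Real.Gamma (1 - α) := Real.Gamma_pos_of_pos (by linarith [hα.2])
  have hp : 0 < u ^ α := Real.rpow_pos_of_pos hu.1 _
  have huT : u ^ α ≤ T ^ α := Real.rpow_le_rpow hu.1.le hu.2 hα.1.le
  have hint : |∫ s in (0 : ℝ)..u, (f u - f s) / (u - s) ^ (α + 1)| ≤ ‖f‖ :=
    (intervalIntegral.abs_integral_le_integral_abs hu.1.le).trans
      (f.integral_abs_incr_le ⟨hu.1.le, hu.2⟩)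
  have hsum : |f u / u ^ α + α * ∫ s in (0 : ℝ)..u, (f u - f s) / (u - s) ^ (α + 1)| ≤
      (1 + T ^ α) * ‖f‖ / u ^ α := by
    refine (abs_add_le _ _).trans ?_
    rw [abs_div, abs_mul, abs_of_pos hp, abs_of_pos hα.1, add_mul, add_div, one_mul]
    gcongr
    · exact f.abs_apply_le u
    · rw [le_div_iff₀ hp]
      calc α * |∫ s in (0 : ℝ)..u, (f u - f s) / (u - s) ^ (α + 1)| * u ^ α
          ≤ 1 * ‖f‖ * T ^ α := by
            gcongr
            exact hα.2.le
        _ = T ^ α * ‖f‖ := by ring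
  rw [leftFracDeriv, abs_mul, abs_of_pos (by positivity), sub_zero, Real.rpow_neg hu.1.le]
  calc _ ≤ 1 / Real.Gamma (1 - α) * ((1 + T ^ α) * ‖f‖ / u ^ α) := by gcongr
    _ = _ := by ring

end LeftDerivative

section RightDerivative

variable {α T s t u : ℝ}

/-- The right-sided fractional derivative `D_{t-}^{1-α} g_{t-}(u)`, `g_{t-} = g - g(t)`, without
its phase factor. -/
def rightFracDerivSub (α : ℝ) (g : ℝ → ℝ) (t u : ℝ) : ℝ :=
  rightFracDeriv (1 - α) t (fun s => g s - g t) u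

theorem rightFracDerivSub_eq (α : ℝ) (g : ℝ → ℝ) (t u : ℝ) :
    rightFracDerivSub α g t u = 1 / Real.Gamma α * ((g u - g t) / (t - u) ^ (1 - α) +
      (1 - α) * ∫ y in u..t, (g u - g y) / (y - u) ^ (2 - α)) := by
  simp only [rightFracDerivSub, rightFracDeriv, sub_sub_cancel, sub_sub_sub_cancel_right,
    show 1 - α + 1 = 2 - α by ring]

theorem rightFracDerivSub_add (g h : W2 α T) (hu : 0 ≤ u) (hut : u ≤ t) (ht : t ≤ T) :
    rightFracDerivSub α (g + h) t u = rightFracDerivSub α g t u + rightFracDerivSub α h t u := by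
  rcases hut.eq_or_lt with rfl | hut
  · simp [rightFracDerivSub_eq]
  simp only [rightFracDerivSub_eq, Pi.add_apply, add_sub_add_comm, add_div]
  rw [intervalIntegral.integral_add (g.intervalIntegrable_incr hu hut ht)
    (h.intervalIntegrable_incr hu hut ht)]
  ring

theorem rightFracDerivSub_smul (c : ℝ) (g : ℝ → ℝ) (t u : ℝ) :
    rightFracDerivSub α (c • g) t u = c * rightFracDerivSub α g t u := by
  simp only [rightFracDerivSub_eq, Pi.smul_apply, smul_eq_mul, ← mul_sub, mul_div_assoc,
    intervalIntegral.integral_const_mul]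
  ring

theorem aestronglyMeasurable_rightFracDerivSub (g : W2 α T) (ht : t ≤ T) :
    AEStronglyMeasurable (rightFracDerivSub α g t) (volume.restrict (Icc 0 t)) := by
  have hg : AEMeasurable g (volume.restrict (Icc 0 t)) :=
    g.2.2.1.mono_set (Icc_subset_Icc_right ht)
  have hD : MeasurableSet {q : ℝ × ℝ | q.1 < q.2 ∧ q.2 ≤ t} :=
    (measurableSet_lt measurable_fst measurable_snd).inter
      (measurableSet_le measurable_snd measurable_const)
  have hint : AEStronglyMeasurable (fun u => ∫ y in u..t, (g u - g y) / (y - u) ^ (2 - α))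
      (volume.restrict (Icc 0 t)) := by
    refine (aestronglyMeasurable_integral_incr measurableSet_Icc hg hD
      (k := fun q => (q.2 - q.1) ^ (2 - α)) (by fun_prop)
      fun u hu v hv => ⟨hu.1.trans hv.1.le, hv.2⟩).congr ?_
    filter_upwards [ae_restrict_mem measurableSet_Icc] with u hu
    rw [intervalIntegral.integral_of_le hu.2]
    rfl
  have hquot : AEMeasurable (fun u => (g u - g t) / (t - u) ^ (1 - α))
      (volume.restrict (Icc 0 t)) := (hg.sub_const _).div (by fun_prop)
  rw [funext (rightFracDerivSub_eq α g t)]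
  exact (hquot.aestronglyMeasurable.add (hint.const_mul _)).const_mul _

theorem abs_rightFracDerivSub_le (hα : α ∈ Ioo (0 : ℝ) 1) (g : W2 α T) (hu : 0 ≤ u)
    (hut : u < t) (ht : t ≤ T) : |rightFracDerivSub α g t u| ≤ 1 / Real.Gamma α * ‖g‖ := by
  have hΓ : 0 < Real.Gamma α := Real.Gamma_pos_of_pos hα.1
  have hint := intervalIntegral.abs_integral_le_integral_abs (μ := volume)
    (f := fun y => (g u - g y) / (y - u) ^ (2 - α)) hut.le
  rw [rightFracDerivSub_eq, abs_mul, abs_of_pos (by positivity)]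
  gcongr
  refine (abs_add_le _ _).trans (le_trans ?_ (g.abs_div_add_integral_abs_incr_le hu hut ht))
  rw [abs_mul, abs_of_pos (sub_pos.2 hα.2)]
  gcongr
  exact (mul_le_of_le_one_left (abs_nonneg _) (by linarith [hα.1])).trans hint

theorem intervalIntegrable_sub_right_rpow_of_lt (p : ℝ) (hus : u < s) (hst : s ≤ t) :
    IntervalIntegrable (fun y => (y - u) ^ p) volume s t := by
  have h0 : (0 : ℝ) ∉ uIcc (s - u) (t - u) := by
    rw [uIcc_of_le (by linarith)]
    exact fun h => (sub_pos.2 hus).not_ge h.1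
  simpa using (intervalIntegral.intervalIntegrable_rpow (μ := volume) (r := p)
    (Or.inr h0)).comp_sub_right u

theorem integral_sub_right_rpow_of_lt {p : ℝ} (hp : p ≠ -1) (hus : u < s) (hst : s ≤ t) :
    ∫ y in s..t, (y - u) ^ p = ((t - u) ^ (p + 1) - (s - u) ^ (p + 1)) / (p + 1) := by
  have h0 : (0 : ℝ) ∉ uIcc (s - u) (t - u) := by
    rw [uIcc_of_le (by linarith)]
    exact fun h => (sub_pos.2 hus).not_ge h.1
  rw [intervalIntegral.integral_comp_sub_right (fun x => x ^ p), integral_rpow (Or.inr ⟨hp, h0⟩)]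

theorem W2.integral_incr_eq (g : W2 α T) (hu : 0 ≤ u) (hus : u < s) (hst : s ≤ t) (ht : t ≤ T) :
    ∫ y in s..t, (g s - g y) / (y - u) ^ (2 - α) =
      (∫ y in s..t, (g u - g y) / (y - u) ^ (2 - α)) -
        (g u - g s) * ∫ y in s..t, (y - u) ^ (-(2 - α)) := by
  have hi : IntervalIntegrable (fun y => (g u - g y) / (y - u) ^ (2 - α)) volume s t :=
    (g.intervalIntegrable_incr hu (hus.trans_le hst) ht).mono_set (by
      rw [uIcc_of_le hst, uIcc_of_le (hus.le.trans hst)]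
      exact Icc_subset_Icc_left hus.le)
  rw [← intervalIntegral.integral_const_mul, ← intervalIntegral.integral_sub hi
    ((intervalIntegrable_sub_right_rpow_of_lt _ hus hst).const_mul _)]
  refine intervalIntegral.integral_congr fun y hy => ?_
  rw [uIcc_of_le hst] at hy
  rw [Real.rpow_neg (by linarith [hy.1])]
  ring

theorem rightFracDerivSub_sub_eq (hα : α < 1) (g : W2 α T) (hu : 0 ≤ u) (hus : u < s)
    (hst : s ≤ t) (ht : t ≤ T) :
    rightFracDerivSub α g t u - rightFracDerivSub α g s u =
      1 / Real.Gamma α * ((g s - g t) / (t - u) ^ (1 - α) +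
        (1 - α) * ∫ y in s..t, (g s - g y) / (y - u) ^ (2 - α)) := by
  have hkernel : (1 - α) * ∫ y in s..t, (y - u) ^ (-(2 - α)) =
      1 / (s - u) ^ (1 - α) - 1 / (t - u) ^ (1 - α) := by
    have h1 : 1 - α ≠ 0 := by linarith
    rw [integral_sub_right_rpow_of_lt (by linarith) hus hst,
      show -(2 - α) + 1 = -(1 - α) by ring, Real.rpow_neg (by linarith),
      Real.rpow_neg (by linarith)]
    field_simp
    ring
  have hut := hus.trans_le hst
  have hi := g.intervalIntegrable_incr hu hut ht
  have hsub : uIcc u s ⊆ uIcc u t ∧ uIcc s t ⊆ uIcc u t := by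
    rw [uIcc_of_le hst, uIcc_of_le hus.le, uIcc_of_le hut.le]
    exact ⟨Icc_subset_Icc_right hst, Icc_subset_Icc_left hus.le⟩
  rw [rightFracDerivSub_eq, rightFracDerivSub_eq, g.integral_incr_eq hu hus hst ht,
    ← intervalIntegral.integral_add_adjacent_intervals (hi.mono_set hsub.1) (hi.mono_set hsub.2)]
  linear_combination (1 / Real.Gamma α * (g u - g s)) * hkernel

theorem W2.abs_integral_incr_le (hα : α < 1) (g : W2 α T) (hs : 0 ≤ s) (hus : u < s)
    (hst : s ≤ t) (ht : t ≤ T) :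
    |∫ y in s..t, (g s - g y) / (y - u) ^ (2 - α)| ≤
      ‖g‖ * (s - u) ^ (α - 1) * ((t - s) ^ (1 - α) / (1 - α)) := by
  have hsu : 0 < s - u := sub_pos.2 hus
  have hbound : ∀ y ∈ Ioo s t, ‖(g s - g y) / (y - u) ^ (2 - α)‖ ≤
      ‖g‖ * (s - u) ^ (α - 1) * (y - s) ^ (-α) := fun y hy => by
    have hys : 0 < y - s := sub_pos.2 hy.1
    have hyu : 0 < y - u := by linarith
    have hden : (y - s) * (s - u) ^ (1 - α) ≤ (y - u) ^ (2 - α) := by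
      rw [show 2 - α = 1 + (1 - α) by ring, Real.rpow_add hyu, Real.rpow_one]
      gcongr
      linarith
    rw [Real.norm_eq_abs, abs_div, abs_of_pos (Real.rpow_pos_of_pos hyu _)]
    calc |g s - g y| / (y - u) ^ (2 - α)
        ≤ ‖g‖ * (y - s) ^ (1 - α) / ((y - s) * (s - u) ^ (1 - α)) := by
          gcongr
          exact g.abs_sub_le hs hy.1 (hy.2.le.trans ht)
      _ = ‖g‖ * (s - u) ^ (α - 1) * (y - s) ^ (-α) := by
          rw [show 1 - α = 1 + -α by ring, Real.rpow_add hys, Real.rpow_one,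
            show α - 1 = -(1 + -α) by ring, Real.rpow_neg hsu.le]
          field_simp
  have h := intervalIntegral.norm_integral_le_of_norm_le (μ := volume) hst
    (ae_mem_Ioc_of_forall_mem_Ioo hbound)
    ((intervalIntegrable_sub_right_rpow (by linarith) s t s).const_mul _)
  rwa [intervalIntegral.integral_const_mul, integral_sub_right_rpow (by linarith),
    show -α + 1 = 1 - α by ring] at h

theorem abs_rightFracDerivSub_sub_le (hα : α ∈ Ioo (0 : ℝ) 1) (g : W2 α T) (hu : 0 ≤ u)
    (hus : u < s) (hst : s < t) (ht : t ≤ T) :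
    |rightFracDerivSub α g t u - rightFracDerivSub α g s u| ≤
      2 / Real.Gamma α * ‖g‖ * (t - s) ^ (1 - α) * (s - u) ^ (α - 1) := by
  have hΓ : 0 < Real.Gamma α := Real.Gamma_pos_of_pos hα.1
  have hα1 : 0 < 1 - α := sub_pos.2 hα.2
  have hs : 0 ≤ s := hu.trans hus.le
  have hsu : 0 < s - u := sub_pos.2 hus
  have hts : 0 < t - s := sub_pos.2 hst
  have hpoint : |(g s - g t) / (t - u) ^ (1 - α)| ≤
      ‖g‖ * (t - s) ^ (1 - α) * (s - u) ^ (α - 1) := by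
    rw [abs_div, abs_of_pos (Real.rpow_pos_of_pos (by linarith) _),
      show α - 1 = -(1 - α) by ring, Real.rpow_neg hsu.le, ← div_eq_mul_inv]
    gcongr
    exact g.abs_sub_le hs hst ht
  have hint : |(1 - α) * ∫ y in s..t, (g s - g y) / (y - u) ^ (2 - α)| ≤
      ‖g‖ * (t - s) ^ (1 - α) * (s - u) ^ (α - 1) := by
    rw [abs_mul, abs_of_pos hα1]
    calc _ ≤ (1 - α) * (‖g‖ * (s - u) ^ (α - 1) * ((t - s) ^ (1 - α) / (1 - α))) := by
          gcongr
          exact g.abs_integral_incr_le hα.2 hs hus hst.le ht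
      _ = _ := by field_simp
  rw [rightFracDerivSub_sub_eq hα.2 g hu hus hst.le ht, abs_mul, abs_of_pos (by positivity)]
  calc _ ≤ 1 / Real.Gamma α * (‖g‖ * (t - s) ^ (1 - α) * (s - u) ^ (α - 1) +
        ‖g‖ * (t - s) ^ (1 - α) * (s - u) ^ (α - 1)) := by
        gcongr
        exact (abs_add_le _ _).trans (add_le_add hpoint hint)
    _ = _ := by ring

end RightDerivative

section Stieltjes

variable {α T s t : ℝ}

theorem stieltjes_congr {f f' : ℝ → ℝ} (g : ℝ → ℝ) (ht : 0 ≤ t)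
    (h : EqOn f f' (Ioc 0 t)) : stieltjes α 0 t f g = stieltjes α 0 t f' g := by
  rw [stieltjes, stieltjes]
  congr 1
  refine intervalIntegral.integral_congr_ae (Filter.Eventually.of_forall fun u hu => ?_)
  rw [uIoc_of_le ht] at hu
  rw [leftFracDeriv_congr hu.1 fun v hv => h ⟨hv.1, hv.2.trans hu.2⟩]

theorem stieltjes_eq (α t : ℝ) (f g : ℝ → ℝ) : stieltjes α 0 t f g =
    -∫ u in (0 : ℝ)..t, leftFracDeriv α 0 f u * rightFracDerivSub α g t u := rfl

theorem stieltjes_self (α t : ℝ) (f g : ℝ → ℝ) : stieltjes α t t f g = 0 := by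
  simp [stieltjes]

/-- The constant `c` for which `t ↦ ∫_0^t f dg` is `(1-α)`-Hölder on `[0,T]` with constant
`c ‖f‖_{α,1} ‖g‖_{1-α,2}`. -/
def stieltjesConst (α T : ℝ) : ℝ :=
  ((1 - α)⁻¹ + 2 * ProbabilityTheory.beta (1 - α) α) *
    ((1 + T ^ α) / Real.Gamma (1 - α) / Real.Gamma α)

theorem stieltjesConst_nonneg (hα : α ∈ Ioo (0 : ℝ) 1) (hT : 0 ≤ T) : 0 ≤ stieltjesConst α T := by
  have h1 : 0 < 1 - α := sub_pos.2 hα.2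
  have h2 := Real.Gamma_pos_of_pos hα.1
  have h3 := ProbabilityTheory.beta_pos h1 hα.1
  rw [stieltjesConst]
  positivity

theorem intervalIntegrable_stieltjes (hα : α ∈ Ioo (0 : ℝ) 1) (f : W1 α 0 T) (g : W2 α T)
    (ht : t ∈ Icc 0 T) :
    IntervalIntegrable (fun u => leftFracDeriv α 0 f u * rightFracDerivSub α g t u) volume 0 t :=
  intervalIntegrable_mul_of_abs_le_rpow hα.2 ht.1
    ((aestronglyMeasurable_leftFracDeriv f).mono_set
      (Ioo_subset_Icc_self.trans (Icc_subset_Icc_right ht.2)))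
    ((aestronglyMeasurable_rightFracDerivSub g ht.2).mono_set Ioo_subset_Icc_self)
    (fun _ hu => abs_leftFracDeriv_le hα f ⟨hu.1, hu.2.le.trans ht.2⟩)
    fun _ hu => abs_rightFracDerivSub_le hα g hu.1.le hu.2 ht.2

theorem stieltjes_sub_eq (hα : α ∈ Ioo (0 : ℝ) 1) (f : W1 α 0 T) (g : W2 α T) (hs : 0 ≤ s)
    (hst : s ≤ t) (ht : t ≤ T) : stieltjes α 0 t f g - stieltjes α 0 s f g =
      -((∫ u in s..t, leftFracDeriv α 0 f u * rightFracDerivSub α g t u) +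
        ∫ u in (0 : ℝ)..s, leftFracDeriv α 0 f u *
          (rightFracDerivSub α g t u - rightFracDerivSub α g s u)) := by
  have hit := intervalIntegrable_stieltjes hα f g ⟨hs.trans hst, ht⟩
  have his := intervalIntegrable_stieltjes hα f g ⟨hs, hst.trans ht⟩
  have hmem : s ∈ uIcc 0 t := by
    rw [uIcc_of_le (hs.trans hst)]
    exact ⟨hs, hst⟩
  have hit₀ := hit.mono_set (uIcc_subset_uIcc_left hmem)
  simp only [mul_sub]
  rw [stieltjes_eq, stieltjes_eq, intervalIntegral.integral_sub hit₀ his,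
    ← intervalIntegral.integral_add_adjacent_intervals hit₀
      (hit.mono_set (uIcc_subset_uIcc_right hmem))]
  ring

theorem abs_stieltjes_sub_le (hα : α ∈ Ioo (0 : ℝ) 1) (f : W1 α 0 T) (g : W2 α T) (hs : 0 ≤ s)
    (hst : s < t) (ht : t ≤ T) : |stieltjes α 0 t f g - stieltjes α 0 s f g| ≤
      stieltjesConst α T * ‖f‖ * ‖g‖ * (t - s) ^ (1 - α) := by
  have hΓ := Real.Gamma_pos_of_pos hα.1
  have hΓ' := Real.Gamma_pos_of_pos (sub_pos.2 hα.2)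
  have hT : 0 ≤ T := hs.trans (hst.le.trans ht)
  have hnear := abs_integral_mul_le_of_abs_le_rpow hα.1.le hα.2 (by positivity) hs hst.le
    (fun u hu => abs_leftFracDeriv_le hα f ⟨hs.trans_lt hu.1, hu.2.le.trans ht⟩)
    (fun u hu => abs_rightFracDerivSub_le hα g (hs.trans hu.1.le) hu.2 ht)
  have hfar := abs_integral_mul_le_of_abs_le_rpow_sub hα.1 hα.2 (by positivity)
    (by positivity) hs
    (fun u hu => abs_leftFracDeriv_le hα f ⟨hu.1, hu.2.le.trans (hst.le.trans ht)⟩)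
    (fun u hu => abs_rightFracDerivSub_sub_le hα g hu.1.le hu.2 hst ht)
  rw [stieltjes_sub_eq hα f g hs hst.le ht, abs_neg]
  refine ((abs_add_le _ _).trans (add_le_add hnear hfar)).trans (le_of_eq ?_)
  rw [stieltjesConst]
  ring

theorem stieltjes_add_left (hα : α ∈ Ioo (0 : ℝ) 1) (f f' : W1 α 0 T) (g : W2 α T)
    (ht : t ∈ Icc 0 T) :
    stieltjes α 0 t (f + f') g = stieltjes α 0 t f g + stieltjes α 0 t f' g := by
  rw [stieltjes_eq, stieltjes_eq, stieltjes_eq, ← neg_add,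
    ← intervalIntegral.integral_add (intervalIntegrable_stieltjes hα f g ht)
      (intervalIntegrable_stieltjes hα f' g ht)]
  congr 1
  refine intervalIntegral.integral_congr fun u hu => ?_
  rw [uIcc_of_le ht.1] at hu
  rw [leftFracDeriv_add f f' ⟨hu.1, hu.2.trans ht.2⟩, add_mul]

theorem stieltjes_smul_left (c : ℝ) (f g : ℝ → ℝ) (t : ℝ) :
    stieltjes α 0 t (c • f) g = c * stieltjes α 0 t f g := by
  simp only [stieltjes_eq, leftFracDeriv_smul, mul_assoc, intervalIntegral.integral_const_mul,
    mul_neg]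

theorem stieltjes_add_right (hα : α ∈ Ioo (0 : ℝ) 1) (f : W1 α 0 T) (g g' : W2 α T)
    (ht : t ∈ Icc 0 T) :
    stieltjes α 0 t f (g + g') = stieltjes α 0 t f g + stieltjes α 0 t f g' := by
  rw [stieltjes_eq, stieltjes_eq, stieltjes_eq, ← neg_add,
    ← intervalIntegral.integral_add (intervalIntegrable_stieltjes hα f g ht)
      (intervalIntegrable_stieltjes hα f g' ht)]
  congr 1
  refine intervalIntegral.integral_congr fun u hu => ?_
  rw [uIcc_of_le ht.1] at hu
  rw [rightFracDerivSub_add g g' hu.1 hu.2 ht.2, mul_add]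

theorem stieltjes_smul_right (c : ℝ) (f g : ℝ → ℝ) (t : ℝ) :
    stieltjes α 0 t f (c • g) = c * stieltjes α 0 t f g := by
  simp only [stieltjes_eq, rightFracDerivSub_smul, mul_left_comm _ c,
    intervalIntegral.integral_const_mul, mul_neg]

/-- The indefinite generalized Stieltjes integral `t ↦ ∫_0^t f dg`. -/
def W1.stieltjes (hα : α ∈ Ioo (0 : ℝ) (1 / 2)) (hT : 0 ≤ T) (f : W1 α 0 T) (g : W2 α T) :
    W1 α 0 T :=
  have hα₁ : α ∈ Ioo (0 : ℝ) 1 := Ioo_subset_Ioo_right (by norm_num) hα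
  W1.ofHolder (F := fun t => FracDelay.stieltjes α 0 t f g) hα.2
    (mul_nonneg (mul_nonneg (stieltjesConst_nonneg hα₁ hT) (norm_nonneg f)) (norm_nonneg g))
    (fun _ hu _ hv => abs_stieltjes_sub_le hα₁ f g hv.1 hv.2 hu.2) (stieltjes_self α 0 f g)

theorem W1.stieltjes_apply (hα : α ∈ Ioo (0 : ℝ) (1 / 2)) (hT : 0 ≤ T) (f : W1 α 0 T)
    (g : W2 α T) (ht : t ∈ Icc 0 T) :
    W1.stieltjes hα hT f g t = FracDelay.stieltjes α 0 t f g := by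
  rw [W1.stieltjes, W1.ofHolder_apply _ _ _ _ ht]

theorem W1.norm_stieltjes_le (hα : α ∈ Ioo (0 : ℝ) (1 / 2)) (hT : 0 ≤ T) (f : W1 α 0 T)
    (g : W2 α T) :
    ‖W1.stieltjes hα hT f g‖ ≤ stieltjesConst α T * ‖f‖ * ‖g‖ * holderConst α (T - 0) := by
  rw [W1.stieltjes]
  exact W1.norm_ofHolder_le _ _ _ _ hT

/-- `W1.stieltjes` as a continuous bilinear map. -/
def stieltjesCLM (hα : α ∈ Ioo (0 : ℝ) (1 / 2)) (hT : 0 ≤ T) :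
    W1 α 0 T →L[ℝ] W2 α T →L[ℝ] W1 α 0 T :=
  have hα₁ : α ∈ Ioo (0 : ℝ) 1 := Ioo_subset_Ioo_right (by norm_num) hα
  LinearMap.mkContinuous₂ (LinearMap.mk₂ ℝ (W1.stieltjes hα hT)
    (fun f f' g => W1.ext fun t ht => by
      simp only [W1.add_apply, W1.stieltjes_apply hα hT _ _ ht]
      exact stieltjes_add_left hα₁ f f' g ht)
    (fun c f g => W1.ext fun t ht => by
      simp only [W1.smul_apply, W1.stieltjes_apply hα hT _ _ ht]
      exact stieltjes_smul_left c f g t)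
    (fun f g g' => W1.ext fun t ht => by
      simp only [W1.add_apply, W1.stieltjes_apply hα hT _ _ ht]
      exact stieltjes_add_right hα₁ f g g' ht)
    (fun c f g => W1.ext fun t ht => by
      simp only [W1.smul_apply, W1.stieltjes_apply hα hT _ _ ht]
      exact stieltjes_smul_right c f g t))
    (stieltjesConst α T * holderConst α (T - 0)) fun f g =>
      (W1.norm_stieltjes_le hα hT f g).trans (le_of_eq (by ring))

theorem stieltjesCLM_apply (hα : α ∈ Ioo (0 : ℝ) (1 / 2)) (hT : 0 ≤ T) (f : W1 α 0 T)
    (g : W2 α T) (ht : t ∈ Icc 0 T) : stieltjesCLM hα hT f g t = stieltjes α 0 t f g :=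
  W1.stieltjes_apply hα hT f g ht

end Stieltjes

section Completeness

open Filter Topology

variable {α a b : ℝ}

theorem w1ENorm_le_of_tendsto {F : ℕ → ℝ → ℝ} {f : ℝ → ℝ} {C : ℝ≥0∞}
    (hF : ∀ n, AEMeasurable (F n) (volume.restrict (Icc a b)))
    (hlim : ∀ t ∈ Icc a b, Tendsto (fun n => F n t) atTop (𝓝 (f t)))
    (hC : ∀ᶠ n in atTop, w1ENorm α a b (F n) ≤ C) : w1ENorm α a b f ≤ C := by
  rw [w1ENorm_eq]
  refine iSup₂_le fun u hu => ?_
  have hbound : ∀ᶠ n in atTop,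
      ‖F n u‖ₑ + ∫⁻ v in Ioo a u, ‖(F n u - F n v) / (u - v) ^ (α + 1)‖ₑ ≤ C := by
    filter_upwards [hC] with n hn
    rw [w1ENorm_eq] at hn
    exact (le_iSup₂_of_le u hu le_rfl).trans hn
  have hu_lim : Tendsto (fun n => ‖F n u‖ₑ) atTop (𝓝 ‖f u‖ₑ) := (hlim u hu).enorm
  have hfu : ‖f u‖ₑ ≤ C := le_of_tendsto hu_lim (hbound.mono fun _ h => le_self_add.trans h)
  suffices h : ∫⁻ v in Ioo a u, ‖(f u - f v) / (u - v) ^ (α + 1)‖ₑ ≤ C - ‖f u‖ₑ from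
    (add_le_add_right h _).trans_eq (add_tsub_cancel_of_le hfu)
  have hkernel : ∀ v ∈ Ioo a u, liminf (fun n => ‖(F n u - F n v) / (u - v) ^ (α + 1)‖ₑ) atTop =
      ‖(f u - f v) / (u - v) ^ (α + 1)‖ₑ := fun v hv =>
    (((hlim u hu).sub (hlim v ⟨hv.1.le, hv.2.le.trans hu.2⟩)).div_const _).enorm.liminf_eq
  have hmeas : ∀ n, AEMeasurable (fun v => ‖(F n u - F n v) / (u - v) ^ (α + 1)‖ₑ)
      (volume.restrict (Ioo a u)) := fun n =>
    ((aemeasurable_const.sub ((hF n).mono_set (Ioo_subset_Icc_self.trans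
      (Icc_subset_Icc_right hu.2)))).div (by fun_prop)).enorm
  calc ∫⁻ v in Ioo a u, ‖(f u - f v) / (u - v) ^ (α + 1)‖ₑ
      = ∫⁻ v in Ioo a u, liminf (fun n => ‖(F n u - F n v) / (u - v) ^ (α + 1)‖ₑ) atTop :=
        (setLIntegral_congr_fun measurableSet_Ioo hkernel).symm
    _ ≤ liminf (fun n => ∫⁻ v in Ioo a u, ‖(F n u - F n v) / (u - v) ^ (α + 1)‖ₑ) atTop :=
        lintegral_liminf_le' hmeas
    _ ≤ liminf (fun n => C - ‖F n u‖ₑ) atTop :=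
        liminf_le_liminf (hbound.mono fun _ h => ENNReal.le_sub_of_add_le_left enorm_ne_top h)
    _ = C - ‖f u‖ₑ :=
        (ENNReal.Tendsto.sub tendsto_const_nhds hu_lim (Or.inr enorm_ne_top)).liminf_eq

theorem W1.lipschitzWith_apply (t : ℝ) : LipschitzWith 1 fun f : W1 α a b => f t :=
  LipschitzWith.of_dist_le_mul fun f g => by
    rw [NNReal.coe_one, one_mul, dist_eq_norm, dist_eq_norm]
    exact (f - g).abs_apply_le t

instance (α a b : ℝ) : CompleteSpace (W1 α a b) := by
  refine Metric.complete_of_cauchySeq_tendsto fun x hx => ?_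
  have hpt : ∀ t, ∃ y, Tendsto (fun n => x n t) atTop (𝓝 y) := fun t =>
    cauchySeq_tendsto_of_complete ((W1.lipschitzWith_apply t).uniformContinuous.comp_cauchySeq hx)
  choose f hf using hpt
  have hle : ∀ ε > 0, ∃ N, ∀ n ≥ N, w1ENorm α a b (f - x n) ≤ ENNReal.ofReal ε := fun ε hε => by
    obtain ⟨N, hN⟩ := Metric.cauchySeq_iff.1 hx ε hε
    refine ⟨N, fun n hn => w1ENorm_le_of_tendsto (F := fun m => ⇑(x m - x n))
      (fun m => (x m - x n).2.2.1) (fun t _ => (hf t).sub_const _) ?_⟩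
    filter_upwards [eventually_ge_atTop N] with m hm
    rw [W1.w1ENorm_coe, ← dist_eq_norm]
    exact ENNReal.ofReal_le_ofReal (hN m hm n hn).le
  have hmeas : AEMeasurable f (volume.restrict (Icc a b)) :=
    aemeasurable_of_tendsto_metrizable_ae atTop (fun n => (x n).2.2.1)
      (Eventually.of_forall hf)
  obtain ⟨N, hN⟩ := hle 1 one_pos
  have hfin : w1ENorm α a b f < ∞ := by
    rw [← add_sub_cancel (x N : ℝ → ℝ) f]
    exact (w1ENorm_add_le α a b (x N).2.2.1).trans_lt
      (ENNReal.add_lt_top.2 ⟨(x N).2.2.2, (hN N le_rfl).trans_lt ENNReal.ofReal_lt_top⟩)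
  refine ⟨W1.ofFun f hmeas hfin, Metric.tendsto_atTop'.2 fun ε hε => ?_⟩
  obtain ⟨N, hN⟩ := hle (ε / 2) (half_pos hε)
  refine ⟨N, fun n hn => ?_⟩
  rw [dist_comm, dist_eq_norm]
  refine (W1.norm_le _ (half_pos hε).le (fun t ht => ?_) (hN n hn.le)).trans_lt (half_lt_self hε)
  rw [W1.sub_apply, W1.ofFun_apply _ _ ht]
  rfl

end Completeness

section Product

variable {α a b : ℝ}

theorem W1.w1ENorm_mul_le (f h : W1 α a b) :
    w1ENorm α a b (fun t => f t * h t) ≤ ENNReal.ofReal (3 * ‖f‖ * ‖h‖) := by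
  have hsup : ∀ u ∈ Icc a b, |f u * h u| ≤ ‖f‖ * ‖h‖ := fun u _ => by
    rw [abs_mul]
    gcongr
    exacts [f.abs_apply_le u, h.abs_apply_le u]
  have hincr : ∀ u ∈ Icc a b, ∀ v ∈ Icc a b,
      |f u * h u - f v * h v| ≤ ‖h‖ * |f u - f v| + ‖f‖ * |h u - h v| := fun u _ v _ => by
    calc |f u * h u - f v * h v| = |h u * (f u - f v) + f v * (h u - h v)| := by ring_nf
      _ ≤ |h u| * |f u - f v| + |f v| * |h u - h v| := by
          simpa only [abs_mul] using abs_add_le (h u * (f u - f v)) (f v * (h u - h v))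
      _ ≤ _ := by
          gcongr
          exacts [h.abs_apply_le u, f.abs_apply_le v]
  exact (w1ENorm_le_of_dominated f h (norm_nonneg h) (norm_nonneg f) hsup hincr).trans_eq
    (by ring_nf)

/-- The pointwise product of two elements of `W1`. -/
def W1.mul (f h : W1 α a b) : W1 α a b :=
  W1.ofFun (fun t => f t * h t) (f.2.2.1.mul h.2.2.1)
    ((f.w1ENorm_mul_le h).trans_lt ENNReal.ofReal_lt_top)

theorem W1.mul_apply (f h : W1 α a b) {t : ℝ} (ht : t ∈ Icc a b) : f.mul h t = f t * h t :=
  W1.ofFun_apply _ _ ht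

/-- Pointwise multiplication on `W1` as a continuous bilinear map. -/
def mulCLM (α a b : ℝ) : W1 α a b →L[ℝ] W1 α a b →L[ℝ] W1 α a b :=
  LinearMap.mkContinuous₂ (LinearMap.mk₂ ℝ W1.mul
    (fun f f' h => W1.ext fun t ht => by
      simp only [W1.add_apply, W1.mul_apply _ _ ht, add_mul])
    (fun c f h => W1.ext fun t ht => by
      simp only [W1.smul_apply, W1.mul_apply _ _ ht, mul_assoc])
    (fun f h h' => W1.ext fun t ht => by
      simp only [W1.add_apply, W1.mul_apply _ _ ht, mul_add])
    (fun c f h => W1.ext fun t ht => by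
      simp only [W1.smul_apply, W1.mul_apply _ _ ht, mul_left_comm]))
    3 fun f h => W1.norm_le _ (by positivity) (fun _ ht => f.mul_apply h ht) (f.w1ENorm_mul_le h)

theorem mulCLM_apply (f h : W1 α a b) {t : ℝ} (ht : t ∈ Icc a b) :
    mulCLM α a b f h t = f t * h t :=
  f.mul_apply h ht

end Product

section TaylorRemainder

variable {φ : ℝ → ℝ}

/-- The first-order Taylor remainder `φ(a + k) - φ(a) - φ'(a) k`. -/
def taylorRem (φ : ℝ → ℝ) (a k : ℝ) : ℝ := φ (a + k) - φ a - deriv φ a * k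

theorem taylorRem_zero (φ : ℝ → ℝ) (a : ℝ) : taylorRem φ a 0 = 0 := by
  simp [taylorRem]

theorem hasDerivAt_taylorRem_right (hφ : Differentiable ℝ φ) (a k : ℝ) :
    HasDerivAt (taylorRem φ a) (deriv φ (a + k) - deriv φ a) k := by
  have hlin : HasDerivAt (fun k => deriv φ a * k) (deriv φ a) k := by
    simpa only [mul_one] using (hasDerivAt_id' k).const_mul (deriv φ a)
  exact (((hφ (a + k)).hasDerivAt.comp_const_add a k).sub_const (φ a)).sub hlin

theorem hasDerivAt_taylorRem_left (hφ : Differentiable ℝ φ) (hφ' : Differentiable ℝ (deriv φ))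
    (a k : ℝ) : HasDerivAt (fun a => taylorRem φ a k) (taylorRem (deriv φ) a k) a :=
  (((hφ (a + k)).hasDerivAt.comp_add_const a k).sub (hφ a).hasDerivAt).sub
    ((hφ' a).hasDerivAt.mul_const k)

theorem exists_abs_taylorRem_sub_le_right (hφ : ContDiff ℝ 1 φ) (R : ℝ) {ε : ℝ} (hε : 0 < ε) :
    ∃ δ > 0, ∀ a ∈ Icc (-R) R, ∀ k ∈ Icc (-δ) δ, ∀ k' ∈ Icc (-δ) δ,
      |taylorRem φ a k - taylorRem φ a k'| ≤ ε * |k - k'| := by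
  have hunif : UniformContinuousOn (deriv φ) (Icc (-(R + 1)) (R + 1)) :=
    isCompact_Icc.uniformContinuousOn_of_continuous
      (hφ.continuous_deriv le_rfl).continuousOn
  obtain ⟨δ, hδ, hcont⟩ := Metric.uniformContinuousOn_iff_le.1 hunif ε hε
  refine ⟨min δ 1, lt_min hδ one_pos, fun a ha k hk k' hk' => ?_⟩
  refine (convex_Icc (-min δ 1) (min δ 1)).norm_image_sub_le_of_norm_hasDerivWithin_le
    (fun z _ => (hasDerivAt_taylorRem_right (hφ.differentiable one_ne_zero) a z).hasDerivWithinAt)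
    (fun z hz => ?_) hk' hk
  have hδ' := min_le_left δ 1
  have h1 := min_le_right δ 1
  refine hcont (a + z) ⟨?_, ?_⟩ a ⟨?_, ?_⟩ ?_
  any_goals linarith [ha.1, ha.2, hz.1, hz.2]
  rw [Real.dist_eq, add_sub_cancel_left, abs_le]
  exact ⟨by linarith [hz.1], by linarith [hz.2]⟩

theorem exists_abs_taylorRem_sub_le_left (hφ : ContDiff ℝ 2 φ) (R : ℝ) {ε : ℝ} (hε : 0 < ε) :
    ∃ δ > 0, ∀ k ∈ Icc (-δ) δ, ∀ a ∈ Icc (-R) R, ∀ a' ∈ Icc (-R) R,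
      |taylorRem φ a k - taylorRem φ a' k| ≤ ε * |k| * |a - a'| := by
  have hφ' : ContDiff ℝ 1 (deriv φ) := ContDiff.deriv' hφ
  obtain ⟨δ, hδ, h⟩ := exists_abs_taylorRem_sub_le_right hφ' R hε
  refine ⟨δ, hδ, fun k hk a ha a' ha' => ?_⟩
  refine (convex_Icc (-R) R).norm_image_sub_le_of_norm_hasDerivWithin_le
    (fun z _ => (hasDerivAt_taylorRem_left (hφ.differentiable two_ne_zero)
      (hφ'.differentiable one_ne_zero) z k).hasDerivWithinAt) (fun z hz => ?_) ha' ha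
  simpa [taylorRem_zero] using h z hz k hk 0 ⟨by linarith, hδ.le⟩

theorem exists_abs_taylorRem_sub_le (hφ : ContDiff ℝ 2 φ) (R : ℝ) {ε : ℝ} (hε : 0 < ε) :
    ∃ δ > 0, ∀ a ∈ Icc (-R) R, ∀ a' ∈ Icc (-R) R, ∀ k ∈ Icc (-δ) δ, ∀ k' ∈ Icc (-δ) δ,
      |taylorRem φ a k - taylorRem φ a' k'| ≤ ε * |k| * |a - a'| + ε * |k - k'| := by
  obtain ⟨δ₁, hδ₁, h₁⟩ := exists_abs_taylorRem_sub_le_left hφ R hε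
  obtain ⟨δ₂, hδ₂, h₂⟩ := exists_abs_taylorRem_sub_le_right (hφ.of_le one_le_two) R hε
  have hsub₁ : Icc (-min δ₁ δ₂) (min δ₁ δ₂) ⊆ Icc (-δ₁) δ₁ :=
    Icc_subset_Icc (neg_le_neg (min_le_left _ _)) (min_le_left _ _)
  have hsub₂ : Icc (-min δ₁ δ₂) (min δ₁ δ₂) ⊆ Icc (-δ₂) δ₂ :=
    Icc_subset_Icc (neg_le_neg (min_le_right _ _)) (min_le_right _ _)
  refine ⟨min δ₁ δ₂, lt_min hδ₁ hδ₂, fun a ha a' ha' k hk k' hk' => ?_⟩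
  exact (abs_sub_le _ (taylorRem φ a' k) _).trans
    (add_le_add (h₁ k (hsub₁ hk) a ha a' ha') (h₂ a' ha' k (hsub₂ hk) k' (hsub₂ hk')))

end TaylorRemainder

section Nemytskii

variable {α a b : ℝ} {φ : ℝ → ℝ}

theorem W1.mem_Icc_norm (f : W1 α a b) (t : ℝ) : f t ∈ Icc (-‖f‖) ‖f‖ := abs_le.1 (f.abs_apply_le t)

theorem W1.w1ENorm_comp_lt_top (hφ : LocallyLipschitz φ) (f : W1 α a b) :
    w1ENorm α a b (fun t => φ (f t)) < ∞ := by
  obtain ⟨K, hK⟩ := LocallyLipschitzOn.exists_lipschitzOnWith_of_compact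
    (isCompact_Icc (a := -‖f‖) (b := ‖f‖)) hφ.locallyLipschitzOn
  have hlip : ∀ x ∈ Icc (-‖f‖) ‖f‖, ∀ y ∈ Icc (-‖f‖) ‖f‖, |φ x - φ y| ≤ K * |x - y| :=
    fun x hx y hy => hK.dist_le_mul x hx y hy
  have hsup : ∀ u ∈ Icc a b, |φ (f u)| ≤ |φ 0| + K * ‖f‖ := fun u _ => by
    have h := hlip (f u) (f.mem_Icc_norm u) 0 ⟨by simp, norm_nonneg f⟩
    have hu : K * |f u - 0| ≤ K * ‖f‖ := by
      rw [sub_zero]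
      gcongr
      exact f.abs_apply_le u
    linarith [abs_sub_abs_le_abs_sub (φ (f u)) (φ 0)]
  refine (w1ENorm_le_of_dominated (c₁ := K) (c₂ := 0) f f K.2 le_rfl hsup
    fun u _ v _ => ?_).trans_lt ENNReal.ofReal_lt_top
  simpa using hlip _ (f.mem_Icc_norm u) _ (f.mem_Icc_norm v)

/-- The superposition (Nemytskii) operator `f ↦ φ ∘ f` on `W1`. -/
def nemytskii (hφ : LocallyLipschitz φ) (f : W1 α a b) : W1 α a b :=
  W1.ofFun (fun t => φ (f t)) (hφ.continuous.measurable.comp_aemeasurable f.2.2.1)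
    (f.w1ENorm_comp_lt_top hφ)

theorem nemytskii_apply (hφ : LocallyLipschitz φ) (f : W1 α a b) {t : ℝ} (ht : t ∈ Icc a b) :
    nemytskii hφ f t = φ (f t) :=
  W1.ofFun_apply _ _ ht

theorem exists_norm_nemytskii_sub_le (hφ : ContDiff ℝ 2 φ) (f : W1 α a b) {ε : ℝ} (hε : 0 < ε) :
    ∃ δ > 0, ∀ k : W1 α a b, ‖k‖ ≤ δ →
      ‖nemytskii (hφ.of_le one_le_two).locallyLipschitz (f + k) -
        nemytskii (hφ.of_le one_le_two).locallyLipschitz f -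
        mulCLM α a b (nemytskii (ContDiff.deriv' hφ).locallyLipschitz f) k‖ ≤
        ε * (2 + ‖f‖) * ‖k‖ := by
  obtain ⟨δ, hδ, h⟩ := exists_abs_taylorRem_sub_le hφ ‖f‖ hε
  refine ⟨δ, hδ, fun k hk => ?_⟩
  have hk' : ∀ t, k t ∈ Icc (-δ) δ := fun t =>
    Icc_subset_Icc (neg_le_neg hk) hk (k.mem_Icc_norm t)
  have hsup : ∀ u ∈ Icc a b, |taylorRem φ (f u) (k u)| ≤ ε * ‖k‖ := fun u _ => by
    have hu := h _ (f.mem_Icc_norm u) _ (f.mem_Icc_norm u) _ (hk' u) 0 ⟨by linarith, hδ.le⟩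
    rw [taylorRem_zero, sub_self, abs_zero, mul_zero, zero_add, sub_zero, sub_zero] at hu
    exact hu.trans (by gcongr; exact k.abs_apply_le u)
  have hincr : ∀ u ∈ Icc a b, ∀ v ∈ Icc a b,
      |taylorRem φ (f u) (k u) - taylorRem φ (f v) (k v)| ≤
        ε * ‖k‖ * |f u - f v| + ε * |k u - k v| := fun u _ v _ => by
    refine (h _ (f.mem_Icc_norm u) _ (f.mem_Icc_norm v) _ (hk' u) _ (hk' v)).trans ?_
    gcongr
    exact k.abs_apply_le u
  refine W1.norm_le (F := fun t => taylorRem φ (f t) (k t)) _ (by positivity) (fun t ht => ?_)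
    ((w1ENorm_le_of_dominated f k (by positivity) hε.le hsup hincr).trans_eq (by ring_nf))
  simp only [W1.sub_apply, mulCLM_apply _ _ ht, nemytskii_apply _ _ ht, W1.add_apply, taylorRem]

theorem hasFDerivAt_nemytskii (hφ : ContDiff ℝ 2 φ) (f : W1 α a b) :
    HasFDerivAt (nemytskii (hφ.of_le one_le_two).locallyLipschitz)
      (mulCLM α a b (nemytskii (ContDiff.deriv' hφ).locallyLipschitz f)) f := by
  rw [hasFDerivAt_iff_isLittleO_nhds_zero, Asymptotics.isLittleO_iff]
  intro c hc
  have hf : 0 < 2 + ‖f‖ := by positivity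
  obtain ⟨δ, hδ, h⟩ := exists_norm_nemytskii_sub_le hφ f (div_pos hc hf)
  filter_upwards [Metric.closedBall_mem_nhds 0 hδ] with k hk
  refine (h k (mem_closedBall_zero_iff.1 hk)).trans_eq ?_
  rw [div_mul_cancel₀ c hf.ne']

end Nemytskii

section Shift

variable {α r T : ℝ}

theorem w1ENorm_comp_sub_right_le (α a b r : ℝ) (f : ℝ → ℝ) :
    w1ENorm α (a + r) (b + r) (fun s => f (s - r)) ≤ w1ENorm α a b f := by
  refine iSup₂_le fun u hu => ?_
  have hp := (measurePreserving_sub_right volume r).setLIntegral_comp_preimage_emb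
    (measurableEmbedding_subRight r)
    (fun v => ‖f (u - r) - f v‖ₑ / ENNReal.ofReal ((u - r - v) ^ (α + 1))) (Ioo a (u - r))
  simp only [preimage_sub_const_Ioo, sub_add_cancel, sub_sub_sub_cancel_right] at hp
  rw [hp]
  exact le_iSup₂_of_le (u - r) ⟨by linarith [hu.1], by linarith [hu.2]⟩ le_rfl

theorem W1.aemeasurable_comp_sub_right (f : W1 α (-r) (T - r)) :
    AEMeasurable (fun s => f (s - r)) (volume.restrict (Icc 0 T)) := by
  have hp := (measurePreserving_sub_right volume r).restrict_preimage_emb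
    (measurableEmbedding_subRight r) (Icc (-r) (T - r))
  simp only [preimage_sub_const_Icc, neg_add_cancel, sub_add_cancel] at hp
  have hf := f.2.2.1
  rw [← hp.map_eq] at hf
  exact hf.comp_measurable hp.measurable

theorem W1.w1ENorm_comp_sub_right_le (f : W1 α (-r) (T - r)) :
    w1ENorm α 0 T (fun s => f (s - r)) ≤ ENNReal.ofReal ‖f‖ := by
  rw [← W1.w1ENorm_coe]
  simpa only [neg_add_cancel, sub_add_cancel] using
    FracDelay.w1ENorm_comp_sub_right_le α (-r) (T - r) r f

/-- The delayed path `s ↦ f (s - r)` on `[0, T]`. -/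
def W1.shift (f : W1 α (-r) (T - r)) : W1 α 0 T :=
  W1.ofFun (fun s => f (s - r)) f.aemeasurable_comp_sub_right
    (f.w1ENorm_comp_sub_right_le.trans_lt ENNReal.ofReal_lt_top)

theorem W1.shift_apply (f : W1 α (-r) (T - r)) {t : ℝ} (ht : t ∈ Icc 0 T) :
    f.shift t = f (t - r) :=
  W1.ofFun_apply _ _ ht

/-- The delay operator, as a contraction from `W_1^α(-r,T-r)` to `W_1^α(0,T)`. -/
def shiftCLM (α r T : ℝ) : W1 α (-r) (T - r) →L[ℝ] W1 α 0 T :=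
  LinearMap.mkContinuous
    { toFun := W1.shift
      map_add' := fun f g => W1.ext fun t ht => by
        simp only [W1.add_apply, W1.shift_apply _ ht]
      map_smul' := fun c f => W1.ext fun t ht => by
        simp only [W1.smul_apply, W1.shift_apply _ ht, RingHom.id_apply] } 1 fun f => by
    rw [one_mul]
    exact W1.norm_le _ (norm_nonneg f) (fun t ht => W1.shift_apply f ht)
      f.w1ENorm_comp_sub_right_le

theorem shiftCLM_apply (f : W1 α (-r) (T - r)) {t : ℝ} (ht : t ∈ Icc 0 T) :
    shiftCLM α r T f t = f (t - r) :=
  f.shift_apply ht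

end Shift

section Integral

variable {α T M : ℝ}

theorem W1.abs_integral_sub_le (hα : 0 ≤ α) (f : W1 α 0 T) (hM : ∀ s ∈ Icc 0 T, |f s| ≤ M) :
    ∀ u ∈ Icc 0 T, ∀ v ∈ Ico 0 u,
      |(∫ s in (0 : ℝ)..u, f s) - ∫ s in (0 : ℝ)..v, f s| ≤ M * T ^ α * (u - v) ^ (1 - α) := by
  intro u hu v hv
  have h0 : (0 : ℝ) ∈ Icc 0 T := ⟨le_rfl, hu.1.trans hu.2⟩
  have hvT : v ∈ Icc 0 T := ⟨hv.1, hv.2.le.trans hu.2⟩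
  have huv : 0 < u - v := sub_pos.2 hv.2
  have hM0 : 0 ≤ M := (abs_nonneg _).trans (hM 0 h0)
  rw [intervalIntegral.integral_interval_sub_left (f.intervalIntegrable h0 hu)
    (f.intervalIntegrable h0 hvT)]
  have hle : ∀ s ∈ uIoc v u, ‖f s‖ ≤ M := fun s hs => by
    rw [uIoc_of_le hv.2.le] at hs
    exact hM s ⟨hv.1.trans hs.1.le, hs.2.trans hu.2⟩
  calc |∫ s in v..u, f s| ≤ M * |u - v| :=
        intervalIntegral.norm_integral_le_of_norm_le_const hle
    _ = M * (u - v) ^ α * (u - v) ^ (1 - α) := by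
        rw [abs_of_pos huv, mul_assoc, ← Real.rpow_add huv, add_sub_cancel, Real.rpow_one]
    _ ≤ M * T ^ α * (u - v) ^ (1 - α) := by
        gcongr
        exact (sub_le_self u hv.1).trans hu.2

/-- The primitive `t ↦ ∫_0^t f` of an element of `W_1^α(0,T)`. -/
def W1.primitive (hα : α ∈ Ioo (0 : ℝ) (1 / 2)) (hT : 0 ≤ T) (f : W1 α 0 T) : W1 α 0 T :=
  W1.ofHolder (F := fun t => ∫ s in (0 : ℝ)..t, f s) hα.2 (by positivity)
    (f.abs_integral_sub_le hα.1.le fun s _ => f.abs_apply_le s) intervalIntegral.integral_same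

theorem W1.primitive_apply (hα : α ∈ Ioo (0 : ℝ) (1 / 2)) (hT : 0 ≤ T) (f : W1 α 0 T) {t : ℝ}
    (ht : t ∈ Icc 0 T) : f.primitive hα hT t = ∫ s in (0 : ℝ)..t, f s := by
  rw [W1.primitive, W1.ofHolder_apply _ _ _ _ ht]

/-- A bound for the operator norm of integration, from bounded functions to `W_1^α(0,T)`. -/
def primitiveConst (α T : ℝ) : ℝ := T ^ α * holderConst α (T - 0)

theorem primitiveConst_nonneg (hα : α < 1 / 2) (hT : 0 ≤ T) : 0 ≤ primitiveConst α T :=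
  mul_nonneg (Real.rpow_nonneg hT α) (holderConst_nonneg hα (sub_nonneg.2 hT))

theorem W1.norm_primitive_le (hα : α ∈ Ioo (0 : ℝ) (1 / 2)) (hT : 0 ≤ T) (f : W1 α 0 T)
    (hM : ∀ s ∈ Icc 0 T, |f s| ≤ M) : ‖f.primitive hα hT‖ ≤ primitiveConst α T * M := by
  have hM0 : 0 ≤ M := (abs_nonneg _).trans (hM 0 ⟨le_rfl, hT⟩)
  refine W1.norm_le _ (mul_nonneg (primitiveConst_nonneg hα.2 hT) hM0)
    (fun t ht => f.primitive_apply hα hT ht) ?_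
  refine (w1ENorm_le_of_holder hα.2 (by positivity) (f.abs_integral_sub_le hα.1.le hM)
    intervalIntegral.integral_same).trans_eq ?_
  rw [primitiveConst, mul_comm _ M, mul_assoc]

/-- Integration from `0` as a continuous linear operator. -/
def primitiveCLM (hα : α ∈ Ioo (0 : ℝ) (1 / 2)) (hT : 0 ≤ T) : W1 α 0 T →L[ℝ] W1 α 0 T :=
  have h0 : (0 : ℝ) ∈ Icc 0 T := ⟨le_rfl, hT⟩
  LinearMap.mkContinuous
    { toFun := W1.primitive hα hT
      map_add' := fun f g => W1.ext fun t ht => by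
        simp only [W1.add_apply, W1.primitive_apply hα hT _ ht]
        exact intervalIntegral.integral_add (f.intervalIntegrable h0 ht)
          (g.intervalIntegrable h0 ht)
      map_smul' := fun c f => W1.ext fun t ht => by
        simp only [W1.smul_apply, W1.primitive_apply hα hT _ ht, RingHom.id_apply]
        exact intervalIntegral.integral_const_mul c f }
    (primitiveConst α T) fun f => f.norm_primitive_le hα hT fun s _ => f.abs_apply_le s

theorem primitiveCLM_apply (hα : α ∈ Ioo (0 : ℝ) (1 / 2)) (hT : 0 ≤ T) (f : W1 α 0 T) {t : ℝ}
    (ht : t ∈ Icc 0 T) : primitiveCLM hα hT f t = ∫ s in (0 : ℝ)..t, f s :=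
  f.primitive_apply hα hT ht

end Integral

section Volterra

open Filter Topology
open scoped NNReal Nat

variable {α T : ℝ} {N : W1 α 0 T → W1 α 0 T} {L : ℝ≥0}

/-- `N` is Lipschitz at each time of `[0, T]` separately, as a superposition operator
`x ↦ ψ(·, x(·))` with `ψ` Lipschitz in the second variable is.  Such an `N` need not be Lipschitz
for the norm of `W_1^α(0,T)`. -/
def PointwiseLipschitz (L : ℝ≥0) (N : W1 α 0 T → W1 α 0 T) : Prop :=
  ∀ x y, ∀ t ∈ Icc 0 T, |N x t - N y t| ≤ L * |x t - y t|

/-- The Picard operator `x ↦ G + ∫_0^· N(x)(s) ds`. -/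
def picard (hα : α ∈ Ioo (0 : ℝ) (1 / 2)) (hT : 0 ≤ T) (N : W1 α 0 T → W1 α 0 T)
    (G x : W1 α 0 T) : W1 α 0 T :=
  G + primitiveCLM hα hT (N x)

variable (hα : α ∈ Ioo (0 : ℝ) (1 / 2)) (hT : 0 ≤ T)

theorem picard_sub_picard (N : W1 α 0 T → W1 α 0 T) (G x y : W1 α 0 T) :
    picard hα hT N G x - picard hα hT N G y = primitiveCLM hα hT (N x - N y) := by
  rw [picard, picard, add_sub_add_left_eq_sub, map_sub]

theorem abs_picard_sub_picard_le (hN : PointwiseLipschitz L N) (G x y : W1 α 0 T) {t : ℝ}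
    (ht : t ∈ Icc 0 T) :
    |picard hα hT N G x t - picard hα hT N G y t| ≤ L * ∫ s in (0 : ℝ)..t, |x s - y s| := by
  rw [← W1.sub_apply, picard_sub_picard, primitiveCLM_apply hα hT _ ht,
    ← intervalIntegral.integral_const_mul]
  have hle : ∀ s ∈ Ioc 0 t, ‖(N x - N y) s‖ ≤ L * |(x - y) s| := fun s hs =>
    hN x y s ⟨hs.1.le, hs.2.trans ht.2⟩
  exact intervalIntegral.norm_integral_le_of_norm_le ht.1 (Eventually.of_forall hle)
    (((x - y).intervalIntegrable ⟨le_rfl, hT⟩ ht).abs.const_mul L)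

theorem norm_picard_sub_picard_le (hN : PointwiseLipschitz L N) (G x y : W1 α 0 T) {M : ℝ}
    (hM : ∀ t ∈ Icc 0 T, |x t - y t| ≤ M) :
    ‖picard hα hT N G x - picard hα hT N G y‖ ≤ primitiveConst α T * (L * M) := by
  rw [picard_sub_picard]
  exact W1.norm_primitive_le hα hT _ fun t ht =>
    (hN x y t ht).trans (mul_le_mul_of_nonneg_left (hM t ht) L.2)

theorem abs_picard_iterate_sub_le (hN : PointwiseLipschitz L N) (G x y : W1 α 0 T) (n : ℕ) :
    ∀ t ∈ Icc 0 T, |(picard hα hT N G)^[n] x t - (picard hα hT N G)^[n] y t| ≤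
      (L * t) ^ n / n ! * ‖x - y‖ := by
  induction n with
  | zero =>
    intro t _
    rw [pow_zero, Nat.factorial_zero, Nat.cast_one, div_one, one_mul]
    exact (x - y).abs_apply_le t
  | succ n ih =>
    intro t ht
    simp only [Function.iterate_succ_apply']
    set x' := (picard hα hT N G)^[n] x
    set y' := (picard hα hT N G)^[n] y
    calc |picard hα hT N G x' t - picard hα hT N G y' t|
        ≤ L * ∫ s in (0 : ℝ)..t, |x' s - y' s| := abs_picard_sub_picard_le hα hT hN G x' y' ht
      _ ≤ L * ∫ s in (0 : ℝ)..t, (L * s) ^ n / n ! * ‖x - y‖ := by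
          gcongr
          refine intervalIntegral.integral_mono_on ht.1
            ((x' - y').intervalIntegrable ⟨le_rfl, hT⟩ ht).abs
            (Continuous.intervalIntegrable (by fun_prop) _ _)
            fun s hs => ih s ⟨hs.1, hs.2.trans ht.2⟩
      _ = (L * t) ^ (n + 1) / (n + 1)! * ‖x - y‖ := by
          simp only [mul_pow, intervalIntegral.integral_mul_const,
            intervalIntegral.integral_div, intervalIntegral.integral_const_mul, integral_pow]
          rw [Nat.factorial_succ, zero_pow n.succ_ne_zero]
          push_cast
          field_simp
          ring

theorem norm_picard_iterate_succ_sub_le (hN : PointwiseLipschitz L N) (G x y : W1 α 0 T) (n : ℕ) :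
    ‖(picard hα hT N G)^[n + 1] x - (picard hα hT N G)^[n + 1] y‖ ≤
      primitiveConst α T * L * ((L * T) ^ n / n !) * ‖x - y‖ := by
  simp only [Function.iterate_succ_apply']
  refine (norm_picard_sub_picard_le hα hT hN G _ _ (M := (L * T) ^ n / n ! * ‖x - y‖)
    fun t ht => (abs_picard_iterate_sub_le hα hT hN G x y n t ht).trans ?_).trans_eq (by ring)
  have ht0 := ht.1
  gcongr
  exact ht.2

theorem exists_contractingWith_picard_iterate (hN : PointwiseLipschitz L N) :
    ∃ n, ∀ G, ContractingWith (1 / 2) (picard hα hT N G)^[n] := by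
  have hlim : Tendsto (fun n : ℕ => primitiveConst α T * L * ((L * T) ^ n / n !)) atTop (𝓝 0) := by
    simpa only [mul_zero] using
      (FloorSemiring.tendsto_pow_div_factorial_atTop (L * T)).const_mul (primitiveConst α T * L)
  obtain ⟨n, hn⟩ := (hlim.eventually_le_const one_half_pos).exists
  refine ⟨n + 1, fun G => ⟨NNReal.half_lt_self one_ne_zero,
    LipschitzWith.of_dist_le_mul fun x y => ?_⟩⟩
  rw [dist_eq_norm, dist_eq_norm]
  refine (norm_picard_iterate_succ_sub_le hα hT hN G x y n).trans ?_
  gcongr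
  simpa using hn

theorem exists_dist_picard_iterate_le (hN : PointwiseLipschitz L N) (n : ℕ) :
    ∃ C : ℝ, ∀ G H x, dist ((picard hα hT N G)^[n] x) ((picard hα hT N H)^[n] x) ≤
      C * dist G H := by
  induction n with
  | zero => exact ⟨0, fun G H x => by simp⟩
  | succ n ih =>
    obtain ⟨C, hC⟩ := ih
    refine ⟨primitiveConst α T * (L * C) + 1, fun G H x => ?_⟩
    simp only [Function.iterate_succ_apply']
    set x' := (picard hα hT N G)^[n] x
    set y' := (picard hα hT N H)^[n] x
    have hxy : ‖x' - y'‖ ≤ C * dist G H := by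
      rw [← dist_eq_norm]
      exact hC G H x
    have hpicard : ‖picard hα hT N G x' - picard hα hT N G y'‖ ≤
        primitiveConst α T * (L * (C * dist G H)) :=
      norm_picard_sub_picard_le hα hT hN G x' y' fun t _ =>
        ((x' - y').abs_apply_le t).trans hxy
    have hGH : dist (picard hα hT N G y') (picard hα hT N H y') = dist G H :=
      dist_add_right _ _ _
    rw [← dist_eq_norm] at hpicard
    exact (dist_triangle _ _ _).trans ((add_le_add hpicard hGH.le).trans_eq (by ring))

/-- The Volterra operator `x ↦ x - ∫_0^· N(x)(s) ds`. -/
def volterra (N : W1 α 0 T → W1 α 0 T) (x : W1 α 0 T) : W1 α 0 T :=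
  x - primitiveCLM hα hT (N x)

theorem volterra_eq_iff_isFixedPt {G x : W1 α 0 T} :
    volterra hα hT N x = G ↔ Function.IsFixedPt (picard hα hT N G) x := by
  rw [volterra, sub_eq_iff_eq_add, Function.IsFixedPt, picard, eq_comm]

theorem volterra_eq_iff {G x : W1 α 0 T} :
    volterra hα hT N x = G ↔ ∀ t ∈ Icc 0 T, x t = G t + ∫ s in (0 : ℝ)..t, N x s := by
  rw [volterra, sub_eq_iff_eq_add]
  refine ⟨fun h t ht => ?_, fun h => W1.ext fun t ht => ?_⟩
  · rw [← primitiveCLM_apply hα hT _ ht, ← W1.add_apply, ← h]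
  · rw [W1.add_apply, primitiveCLM_apply hα hT _ ht, h t ht]

theorem volterra_bijective (hN : PointwiseLipschitz L N) :
    Function.Bijective (volterra hα hT N) := by
  obtain ⟨n, hn⟩ := exists_contractingWith_picard_iterate hα hT hN
  refine Function.bijective_iff_existsUnique _ |>.2 fun G => ?_
  simp only [volterra_eq_iff_isFixedPt]
  exact ⟨_, (hn G).isFixedPt_fixedPoint_iterate,
    fun y hy => (hn G).fixedPoint_unique (hy.iterate n)⟩

/-- `volterra` as a bijection. -/
def volterraEquiv (hN : PointwiseLipschitz L N) : W1 α 0 T ≃ W1 α 0 T :=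
  Equiv.ofBijective (volterra hα hT N) (volterra_bijective hα hT hN)

theorem volterraEquiv_symm_eq_iff (hN : PointwiseLipschitz L N) {G x : W1 α 0 T} :
    (volterraEquiv hα hT hN).symm G = x ↔
      ∀ t ∈ Icc 0 T, x t = G t + ∫ s in (0 : ℝ)..t, N x s := by
  rw [Equiv.symm_apply_eq, eq_comm]
  exact volterra_eq_iff hα hT

theorem continuous_volterraEquiv_symm (hN : PointwiseLipschitz L N) :
    Continuous (volterraEquiv hα hT hN).symm := by
  obtain ⟨n, hn⟩ := exists_contractingWith_picard_iterate hα hT hN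
  obtain ⟨C, hC⟩ := exists_dist_picard_iterate_le hα hT hN n
  have hfix : ∀ G, (volterraEquiv hα hT hN).symm G = ContractingWith.fixedPoint _ (hn G) :=
    fun G => (hn G).fixedPoint_unique (((volterra_eq_iff_isFixedPt hα hT).1
      ((volterraEquiv hα hT hN).apply_symm_apply G)).iterate n)
  refine (LipschitzWith.of_dist_le' (K := C / (1 - (1 / 2 : ℝ≥0))) fun G H => ?_).continuous
  rw [hfix, hfix, div_mul_eq_mul_div]
  exact (hn G).fixedPoint_lipschitz_in_map (hn H) (hC G H)

/-- `volterra` of a linear `A`, as a continuous linear equivalence. -/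
def volterraCLE {A : W1 α 0 T →L[ℝ] W1 α 0 T} (hA : PointwiseLipschitz L A) :
    W1 α 0 T ≃L[ℝ] W1 α 0 T where
  __ := ContinuousLinearMap.id ℝ _ - (primitiveCLM hα hT).comp A
  __ := volterraEquiv hα hT hA
  continuous_toFun := (ContinuousLinearMap.id ℝ _ - (primitiveCLM hα hT).comp A).continuous
  continuous_invFun := continuous_volterraEquiv_symm hα hT hA

theorem volterraCLE_symm_eq_iff {A : W1 α 0 T →L[ℝ] W1 α 0 T} (hA : PointwiseLipschitz L A)
    {G x : W1 α 0 T} : (volterraCLE hα hT hA).symm G = x ↔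
      ∀ t ∈ Icc 0 T, x t = G t + ∫ s in (0 : ℝ)..t, A x s :=
  volterraEquiv_symm_eq_iff hα hT hA

theorem hasFDerivAt_volterra {N' : W1 α 0 T →L[ℝ] W1 α 0 T} {x : W1 α 0 T}
    (hf : HasFDerivAt N N' x) : HasFDerivAt (volterra hα hT N)
      (ContinuousLinearMap.id ℝ _ - (primitiveCLM hα hT).comp N') x :=
  (hasFDerivAt_id x).sub ((primitiveCLM hα hT).hasFDerivAt.comp x hf)

theorem hasFDerivAt_volterraEquiv_symm {K : ℝ≥0} {N' : W1 α 0 T →L[ℝ] W1 α 0 T}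
    (hN : PointwiseLipschitz L N) (hN' : PointwiseLipschitz K N') {G : W1 α 0 T}
    (hf : HasFDerivAt N N' ((volterraEquiv hα hT hN).symm G)) :
    HasFDerivAt (volterraEquiv hα hT hN).symm
      ((volterraCLE hα hT hN').symm : W1 α 0 T →L[ℝ] W1 α 0 T) G :=
  HasFDerivAt.of_local_left_inverse (continuous_volterraEquiv_symm hα hT hN).continuousAt
    (hasFDerivAt_volterra hα hT hf)
    (Eventually.of_forall (volterraEquiv hα hT hN).apply_symm_apply)

end Volterra

section SeminormedCalculus

open Filter Topology Asymptotics

variable {E F F' G : Type*} [SeminormedAddCommGroup E] [NormedSpace ℝ E]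
  [NormedAddCommGroup F] [NormedSpace ℝ F] [SeminormedAddCommGroup F'] [NormedSpace ℝ F']
  [SeminormedAddCommGroup G] [NormedSpace ℝ G] {u : E → F} {u' : E →L[ℝ] F}
  {v : E → F'} {v' : E →L[ℝ] F'} {x : E}

theorem isBigO_sub_of_hasFDerivAt (hv : HasFDerivAt v v' x) :
    (fun y => v y - v x) =O[𝓝 x] fun y => y - x := by
  simpa only [sub_add_cancel] using hv.isLittleO.isBigO.add (v'.isBigO_sub (𝓝 x) x)

theorem tendsto_sub_of_hasFDerivAt (hu : HasFDerivAt u u' x) :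
    Tendsto (fun y => u y - u x) (𝓝 x) (𝓝 0) := by
  have h0 : Tendsto (fun y => ‖y - x‖) (𝓝 x) (𝓝 0) :=
    (continuous_id.sub continuous_const).norm.tendsto' x 0 (by simp)
  exact (isBigO_sub_of_hasFDerivAt hu).norm_right.trans_tendsto h0

theorem hasFDerivAt_comp_of_seminormed {v : F → G} {v' : F →L[ℝ] G}
    (hv : HasFDerivAt v v' (u x)) (hu : HasFDerivAt u u' x) :
    HasFDerivAt (fun y => v (u y)) (v'.comp u') x := by
  have hcont : Tendsto u (𝓝 x) (𝓝 (u x)) :=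
    tendsto_sub_nhds_zero_iff.1 (tendsto_sub_of_hasFDerivAt hu)
  have hv_rem := (hv.isLittleO.comp_tendsto hcont).trans_isBigO (isBigO_sub_of_hasFDerivAt hu)
  have hu_rem := (v'.isBigO_comp (fun y => u y - u x - u' (y - x)) (𝓝 x)).trans_isLittleO
    hu.isLittleO
  refine HasFDerivAt.of_isLittleO ((hv_rem.add hu_rem).congr_left fun y => ?_)
  simp only [Function.comp_apply, map_sub, ContinuousLinearMap.comp_apply]
  abel

theorem hasFDerivAt_bilinear_of_seminormed (B : F →L[ℝ] F' →L[ℝ] G)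
    (hu : HasFDerivAt u u' x) (hv : HasFDerivAt v v' x) :
    HasFDerivAt (fun y => B (u y) (v y)) ((B.flip (v x)).comp u' + (B (u x)).comp v') x := by
  have hu_rem :=
    ((B.flip (v x)).isBigO_comp (fun y => u y - u x - u' (y - x)) (𝓝 x)).trans_isLittleO
      hu.isLittleO
  have hv_rem := ((B (u x)).isBigO_comp (fun y => v y - v x - v' (y - x)) (𝓝 x)).trans_isLittleO
    hv.isLittleO
  have hB : (fun y => B (u y - u x) (v y - v x)) =O[𝓝 x] fun y => ‖u y - u x‖ * ‖v y - v x‖ :=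
    IsBigO.of_bound ‖B‖ (Eventually.of_forall fun y => by
      rw [Real.norm_of_nonneg (by positivity), ← mul_assoc]
      exact B.le_opNorm₂ _ _)
  have hprod : (fun y => ‖u y - u x‖ * ‖v y - v x‖) =o[𝓝 x] fun y => y - x := by
    have hu0 : (fun y => ‖u y - u x‖) =o[𝓝 x] fun _ => (1 : ℝ) :=
      (isLittleO_one_iff ℝ).2 (by simpa using (tendsto_sub_of_hasFDerivAt hu).norm)
    have h := hu0.mul_isBigO (isBigO_sub_of_hasFDerivAt hv).norm_norm
    simp only [one_mul] at h
    exact h.of_norm_right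
  refine HasFDerivAt.of_isLittleO
    (((hu_rem.add hv_rem).add (hB.trans_isLittleO hprod)).congr_left fun y => ?_)
  simp only [map_sub, ContinuousLinearMap.comp_apply, add_apply, sub_apply,
    ContinuousLinearMap.flip_apply]
  abel

end SeminormedCalculus

section Delay

open scoped NNReal

variable {α r T : ℝ} {b σ η : ℝ → ℝ} {L : ℝ≥0}

theorem pointwiseLipschitz_nemytskii (hb : LipschitzWith L b) :
    PointwiseLipschitz L (nemytskii (α := α) (a := 0) (b := T) hb.locallyLipschitz) :=
  fun x y t ht => by
    rw [nemytskii_apply _ x ht, nemytskii_apply _ y ht]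
    exact hb.dist_le_mul (x t) (y t)

theorem pointwiseLipschitz_mulCLM (c : W1 α 0 T) : PointwiseLipschitz ‖c‖₊ (mulCLM α 0 T c) :=
  fun x y t ht => by
    rw [mulCLM_apply _ _ ht, mulCLM_apply _ _ ht, ← mul_sub, abs_mul]
    gcongr
    exact c.abs_apply_le t

theorem integral_congr_of_mem_Icc {f f' : ℝ → ℝ} {t : ℝ} (ht : t ∈ Icc 0 T)
    (h : EqOn f f' (Icc 0 T)) : ∫ s in (0 : ℝ)..t, f s = ∫ s in (0 : ℝ)..t, f' s :=
  intervalIntegral.integral_congr (h.mono (uIcc_subset_Icc ⟨le_rfl, ht.1.trans ht.2⟩ ht))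

/-- The constant function with value `c`. -/
def W1.const (α a b c : ℝ) : W1 α a b :=
  W1.ofFun (fun _ => c) aemeasurable_const
    ((iSup₂_le fun u _ => by simp : w1ENorm α a b (fun _ => c) ≤ ‖c‖ₑ).trans_lt enorm_lt_top)

theorem W1.const_apply {a b t : ℝ} (α c : ℝ) (ht : t ∈ Icc a b) : W1.const α a b c t = c :=
  W1.ofFun_apply _ _ ht

variable (hα : α ∈ Ioo (0 : ℝ) (1 / 2)) (hT : 0 ≤ T)

/-- The forcing term `t ↦ c + ∫_0^t σ(f(s-r)) dg_s` of the delay equation. -/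
def delayForcing (hσ : LocallyLipschitz σ) (c : ℝ) (f : W1 α (-r) (T - r)) (g : W2 α T) :
    W1 α 0 T :=
  W1.const α 0 T c + stieltjesCLM hα hT (nemytskii hσ (shiftCLM α r T f)) g

theorem stieltjesCLM_nemytskii_shift (hσ : LocallyLipschitz σ) (f : W1 α (-r) (T - r))
    (g : W2 α T) {t : ℝ} (ht : t ∈ Icc 0 T) :
    stieltjesCLM hα hT (nemytskii hσ (shiftCLM α r T f)) g t =
      stieltjes α 0 t (fun s => σ (f (s - r))) g := by
  rw [stieltjesCLM_apply hα hT _ _ ht]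
  refine stieltjes_congr g ht.1 fun s hs => ?_
  have hs' : s ∈ Icc 0 T := ⟨hs.1.le, hs.2.trans ht.2⟩
  rw [nemytskii_apply _ _ hs', shiftCLM_apply _ hs']

theorem stieltjesCLM_mul_nemytskii_shift (hσ : LocallyLipschitz σ) (f k : W1 α (-r) (T - r))
    (g : W2 α T) {t : ℝ} (ht : t ∈ Icc 0 T) :
    stieltjesCLM hα hT (mulCLM α 0 T (nemytskii hσ (shiftCLM α r T f)) (shiftCLM α r T k)) g t =
      stieltjes α 0 t (fun s => σ (f (s - r)) * k (s - r)) g := by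
  rw [stieltjesCLM_apply hα hT _ _ ht]
  refine stieltjes_congr g ht.1 fun s hs => ?_
  have hs' : s ∈ Icc 0 T := ⟨hs.1.le, hs.2.trans ht.2⟩
  rw [mulCLM_apply _ _ hs', nemytskii_apply _ _ hs', shiftCLM_apply _ hs', shiftCLM_apply _ hs']

theorem delayForcing_apply (hσ : LocallyLipschitz σ) (c : ℝ) (f : W1 α (-r) (T - r))
    (g : W2 α T) {t : ℝ} (ht : t ∈ Icc 0 T) :
    delayForcing hα hT hσ c f g t = c + stieltjes α 0 t (fun s => σ (f (s - r))) g := by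
  rw [delayForcing, W1.add_apply, W1.const_apply α c ht, stieltjesCLM_nemytskii_shift _ _ _ _ _ ht]

theorem hasFDerivAt_delayForcing (hσ : ContDiff ℝ 2 σ) (c : ℝ)
    {xbar : W2 α T → W1 α (-r) (T - r)} {xbar' : W2 α T →L[ℝ] W1 α (-r) (T - r)} {g : W2 α T}
    (hxbar : HasFDerivAt xbar xbar' g) :
    ∃ D : W2 α T →L[ℝ] W1 α 0 T,
      HasFDerivAt (fun g => delayForcing hα hT (hσ.of_le one_le_two).locallyLipschitz c (xbar g) g)
        D g ∧
      ∀ h, ∀ t ∈ Icc 0 T, D h t = stieltjes α 0 t (fun s => σ (xbar g (s - r))) h +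
        stieltjes α 0 t (fun s => deriv σ (xbar g (s - r)) * xbar' h (s - r)) g := by
  have hconst_add : ∀ y : W1 α 0 T, HasFDerivAt (fun y => W1.const α 0 T c + y)
      (ContinuousLinearMap.id ℝ _) y := fun y => (hasFDerivAt_id y).const_add _
  have hshift := hasFDerivAt_comp_of_seminormed (shiftCLM α r T).hasFDerivAt hxbar
  have hcoeff := hasFDerivAt_comp_of_seminormed (hasFDerivAt_nemytskii hσ _) hshift
  have hint := hasFDerivAt_bilinear_of_seminormed (stieltjesCLM hα hT) hcoeff (hasFDerivAt_id g)
  refine ⟨_, hasFDerivAt_comp_of_seminormed (hconst_add _) hint, fun h t ht => ?_⟩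
  rw [← stieltjesCLM_nemytskii_shift hα hT (hσ.of_le one_le_two).locallyLipschitz _ _ ht,
    ← stieltjesCLM_mul_nemytskii_shift hα hT (ContDiff.deriv' hσ).locallyLipschitz _ _ _ ht,
    add_comm]
  rfl

/-- The solution on `[0, T]` of the equation with initial value `c` and delayed path `f`. -/
def delaySolution (hb : LipschitzWith L b) (hσ : LocallyLipschitz σ) (c : ℝ)
    (f : W1 α (-r) (T - r)) (g : W2 α T) : W1 α 0 T :=
  (volterraEquiv hα hT (pointwiseLipschitz_nemytskii hb)).symm (delayForcing hα hT hσ c f g)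

theorem delaySolution_eq_iff (hb : LipschitzWith L b) (hσ : LocallyLipschitz σ) (c : ℝ)
    (f : W1 α (-r) (T - r)) (g : W2 α T) {x : W1 α 0 T} :
    delaySolution hα hT hb hσ c f g = x ↔ ∀ t ∈ Icc 0 T,
      x t = c + (∫ s in (0 : ℝ)..t, b (x s)) + stieltjes α 0 t (fun s => σ (f (s - r))) g := by
  rw [delaySolution, volterraEquiv_symm_eq_iff]
  refine forall₂_congr fun t ht => ?_
  have hdrift : ∫ s in (0 : ℝ)..t, nemytskii hb.locallyLipschitz x s =
      ∫ s in (0 : ℝ)..t, b (x s) := integral_congr_of_mem_Icc ht fun s hs => nemytskii_apply _ _ hs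
  rw [delayForcing_apply hα hT hσ c f g ht, hdrift, add_right_comm]

theorem hasFDerivAt_delaySolution (hb : ContDiff ℝ 2 b) (hbL : LipschitzWith L b)
    (hσ : ContDiff ℝ 2 σ) (c : ℝ) {xbar : W2 α T → W1 α (-r) (T - r)}
    {xbar' : W2 α T →L[ℝ] W1 α (-r) (T - r)} {g : W2 α T} (hxbar : HasFDerivAt xbar xbar' g)
    {x : ℝ → ℝ}
    (hx : EqOn (delaySolution hα hT hbL (hσ.of_le one_le_two).locallyLipschitz c (xbar g) g) x
      (Icc 0 T)) :
    ∃ D : W2 α T →L[ℝ] W1 α 0 T,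
      HasFDerivAt (fun g =>
        delaySolution hα hT hbL (hσ.of_le one_le_two).locallyLipschitz c (xbar g) g) D g ∧
      ∀ h, ∀ t ∈ Icc 0 T, D h t = (∫ s in (0 : ℝ)..t, deriv b (x s) * D h s) +
        stieltjes α 0 t (fun s => σ (xbar g (s - r))) h +
        stieltjes α 0 t (fun s => deriv σ (xbar g (s - r)) * xbar' h (s - r)) g := by
  obtain ⟨D, hD, hD_apply⟩ := hasFDerivAt_delayForcing hα hT hσ c hxbar
  have hsolve := hasFDerivAt_volterraEquiv_symm hα hT
    (G := delayForcing hα hT (hσ.of_le one_le_two).locallyLipschitz c (xbar g) g)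
    (pointwiseLipschitz_nemytskii hbL) (pointwiseLipschitz_mulCLM _) (hasFDerivAt_nemytskii hb _)
  refine ⟨_, hasFDerivAt_comp_of_seminormed hsolve hD, fun h t ht => ?_⟩
  rw [ContinuousLinearMap.comp_apply, ContinuousLinearEquiv.coe_coe,
    (volterraCLE_symm_eq_iff hα hT _).1 rfl t ht, hD_apply h t ht, add_comm, ← add_assoc]
  congr 2
  refine integral_congr_of_mem_Icc ht fun s hs => ?_
  rw [mulCLM_apply _ _ hs, nemytskii_apply _ _ hs, ← hx hs]
  rfl

theorem isSolution_iff (hb : LipschitzWith L b) (hσ : LocallyLipschitz σ)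
    {f : W1 α (-r) (T - r)} {g : W2 α T} {y : ℝ → ℝ} :
    IsSolution α r T b σ η f g y ↔
      EqOn y η (Icc (-r) 0) ∧ EqOn (delaySolution hα hT hb hσ (η 0) f g) y (Icc 0 T) := by
  have hdrift : ∀ z : W1 α 0 T, EqOn z y (Icc 0 T) → ∀ t ∈ Icc 0 T,
      ∫ s in (0 : ℝ)..t, b (z s) = ∫ s in (0 : ℝ)..t, b (y s) := fun z hz t ht =>
    integral_congr_of_mem_Icc ht fun s hs => by rw [hz hs]
  constructor
  · rintro ⟨⟨z, hz⟩, hinit, heqn⟩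
    refine ⟨hinit, ?_⟩
    rwa [(delaySolution_eq_iff hα hT hb hσ (η 0) f g (x := z)).2 fun t ht => by
      rw [hz ht, heqn t ht, hdrift z hz t ht]]
  · rintro ⟨hinit, hy⟩
    refine ⟨⟨_, hy⟩, hinit, fun t ht => ?_⟩
    rw [← hy ht, (delaySolution_eq_iff hα hT hb hσ (η 0) f g).1 rfl t ht, hdrift _ hy t ht]

end Delay

section ExistsUnique

variable {α r T : ℝ} {b σ : ℝ → ℝ} {L : NNReal}

theorem exists_isSolution (hα : α ∈ Ioo (0 : ℝ) (1 / 2)) (hT : 0 ≤ T) (hb : LipschitzWith L b)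
    (hσ : LocallyLipschitz σ) (η : ℝ → ℝ) (f : W1 α (-r) (T - r)) (g : W2 α T) :
    ∃ y, IsSolution α r T b σ η f g y := by
  have hzero : delaySolution hα hT hb hσ (η 0) f g 0 = η 0 := by
    rw [(delaySolution_eq_iff hα hT hb hσ (η 0) f g).1 rfl 0 ⟨le_rfl, hT⟩,
      intervalIntegral.integral_same, stieltjes_self, add_zero, add_zero]
  refine ⟨fun t => if t ≤ 0 then η t else delaySolution hα hT hb hσ (η 0) f g t,
    (isSolution_iff hα hT hb hσ).2 ⟨fun t ht => if_pos ht.2, fun t ht => ?_⟩⟩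
  rcases ht.1.eq_or_lt with rfl | hpos
  · exact hzero.trans (if_pos le_rfl).symm
  · exact (if_neg hpos.not_ge).symm

theorem eqOn_of_isSolution (hα : α ∈ Ioo (0 : ℝ) (1 / 2)) (hT : 0 ≤ T) (hb : LipschitzWith L b)
    (hσ : LocallyLipschitz σ) {η : ℝ → ℝ} {f : W1 α (-r) (T - r)} {g : W2 α T} {y z : ℝ → ℝ}
    (hy : IsSolution α r T b σ η f g y) (hz : IsSolution α r T b σ η f g z) :
    EqOn y z (Icc (-r) T) := by
  obtain ⟨hy_init, hy_sol⟩ := (isSolution_iff hα hT hb hσ).1 hy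
  obtain ⟨hz_init, hz_sol⟩ := (isSolution_iff hα hT hb hσ).1 hz
  intro t ht
  rcases le_total t 0 with h | h
  · exact (hy_init ⟨ht.1, h⟩).trans (hz_init ⟨ht.1, h⟩).symm
  · exact (hy_sol ⟨h, ht.2⟩).symm.trans (hz_sol ⟨h, ht.2⟩)

end ExistsUnique

theorem IsCkb.exists_lipschitzWith {k : ℕ} {φ : ℝ → ℝ} (hφ : IsCkb (k + 1) φ) :
    ∃ L, LipschitzWith L φ := by
  obtain ⟨C, hC⟩ := hφ.2 1 le_rfl (by lia)
  refine ⟨C.toNNReal, lipschitzWith_of_nnnorm_deriv_le (hφ.1.differentiable (by simp)) fun x => ?_⟩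
  rw [← iteratedDeriv_one]
  exact NNReal.le_toNNReal_of_coe_le (hC x)

end

end FracDelay

theorem theorem5p1_general {α r T : ℝ} (hα : α ∈ Ioo (0 : ℝ) (1 / 2)) (hT : 0 ≤ T)
    {b σ : ℝ → ℝ} (η : ℝ → ℝ) {L : NNReal} (hb : ContDiff ℝ 2 b) (hbL : LipschitzWith L b)
    (hσ : ContDiff ℝ 2 σ) (xbar : FracDelay.W2 α T → FracDelay.W1 α (-r) (T - r)) :
    ∃ x : FracDelay.W2 α T → ℝ → ℝ,
      (∀ g, FracDelay.IsSolution α r T b σ η (xbar g) g (x g)) ∧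
      (∀ g y, FracDelay.IsSolution α r T b σ η (xbar g) g y → EqOn y (x g) (Icc (-r) T)) ∧
      ∃ X : FracDelay.W2 α T → FracDelay.W1 α 0 T,
        (∀ g, EqOn (X g) (x g) (Icc 0 T)) ∧
        ∀ g (xbar' : FracDelay.W2 α T →L[ℝ] FracDelay.W1 α (-r) (T - r)),
          HasFDerivAt xbar xbar' g →
          ∃ DX : FracDelay.W2 α T →L[ℝ] FracDelay.W1 α 0 T, HasFDerivAt X DX g ∧
            ∀ h, ∀ t ∈ Icc 0 T, DX h t =
              (∫ s in (0 : ℝ)..t, deriv b (x g s) * DX h s)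
              + FracDelay.stieltjes α 0 t (fun s => σ (xbar g (s - r))) h
              + FracDelay.stieltjes α 0 t
                  (fun s => deriv σ (xbar g (s - r)) * xbar' h (s - r)) g := by
  have hσ' := (hσ.of_le one_le_two).locallyLipschitz
  choose x hx using fun g => FracDelay.exists_isSolution hα hT hbL hσ' η (xbar g) g
  have hX g := (FracDelay.isSolution_iff hα hT hbL hσ').1 (hx g)
  refine ⟨x, hx, fun g y hy => FracDelay.eqOn_of_isSolution hα hT hbL hσ' hy (hx g), _,
    fun g => (hX g).2, fun g xbar' hxbar => ?_⟩
  exact FracDelay.hasFDerivAt_delaySolution hα hT hb hbL hσ (η 0) hxbar (hX g).2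

theorem theorem5p1 (α r T : ℝ) (hα : α ∈ Ioo (0 : ℝ) (1 / 2)) (hr : 0 < r) (hT : 0 < T)
    (b σ η : ℝ → ℝ) (hb : FracDelay.IsCkb 2 b) (hσ : FracDelay.IsCkb 2 σ)
    -- a continuously Fréchet differentiable map `g ↦ x̄^g`, with derivative `g ↦ Dxbar g`
    (xbar : FracDelay.W2 α T → FracDelay.W1 α (-r) (T - r))
    (Dxbar : FracDelay.W2 α T → FracDelay.W2 α T →L[ℝ] FracDelay.W1 α (-r) (T - r))
    (hxbar : ∀ g, HasFDerivAt xbar (Dxbar g) g) (hDxbar : Continuous Dxbar) :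
    -- the equation has exactly one solution `x^g` for every `g`
    ∃ x : FracDelay.W2 α T → ℝ → ℝ,
      (∀ g, FracDelay.IsSolution α r T b σ η (xbar g) g (x g)) ∧
      (∀ g y, FracDelay.IsSolution α r T b σ η (xbar g) g y → EqOn y (x g) (Icc (-r) T)) ∧
      -- `X` is the map `g ↦ x^g`, with values in `W_1^α(0,T)`, and `DX g h` is `D_h x^g`
      ∃ (X : FracDelay.W2 α T → FracDelay.W1 α 0 T)
        (DX : FracDelay.W2 α T → FracDelay.W2 α T →L[ℝ] FracDelay.W1 α 0 T),
        (∀ g, EqOn (X g) (x g) (Icc 0 T)) ∧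
        (∀ g, HasFDerivAt X (DX g) g) ∧
        ∀ g h, ∀ t ∈ Icc 0 T, DX g h t =
          (∫ s in (0 : ℝ)..t, deriv b (x g s) * DX g h s)
          + FracDelay.stieltjes α 0 t (fun s => σ (xbar g (s - r))) h
          + FracDelay.stieltjes α 0 t
              (fun s => deriv σ (xbar g (s - r)) * Dxbar g h (s - r)) g := by
  obtain ⟨L, hbL⟩ := hb.exists_lipschitzWith
  obtain ⟨x, hx, huniq, X, hX, hDX⟩ := theorem5p1_general hα hT.le η hb.1 hbL hσ.1 xbar
  choose DX hDX hDX_apply using fun g => hDX g _ (hxbar g)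
  exact ⟨x, hx, huniq, X, DX, hX, hDX, hDX_apply⟩
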